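/- Let $\mathbb C_\theta=\{s\in\mathbb C:\operatorname{Re}s>\theta\}$ and let $\mathcal H$ be the Hilbert space of Dirichlet series $f(s)=\sum_{n\ge1}a_nn^{-s}$ with $\|f\|^2=\sum_{n\ge 1}|a_n|^2<\infty$, which are analytic functions on $\mathbb C_{1/2}$. The Gordon--Hedenmalm class $\mathcal G$ consists of the maps $\varphi:\mathbb C_{1/2}\to\mathbb C_{1/2}$ of the form $\varphi(s)=c_0s+\psi(s)$, where $c_0\ge0$ is an integer (the characteristic $\operatorname{char}(\varphi)$ of $\varphi$) and $\psi(s)=\sum_{n\ge1}c_nn^{-s}$ converges uniformly on $\mathbb C_\varepsilon$ for every $\varepsilon>0$ and satisfies: if $c_0=0$, then $\psi(\mathbb C_0)\subseteq\mathbb C_{1/2}$; if $c_0\ge1$, then either $\psi\equiv c_1$ with $\operatorname{Re}c_1\ge0$, or $\psi(\mathbb C_0)\subseteq\mathbb C_0$. For $\varphi\in\mathcal G$ let $C_\varphi f=f\circ\varphi$ be the induced composition operator on $\mathcal H$. Let $p_1<p_2<\cdots$ be the prime numbers. If $c_n=0$ for every $n$ that has a prime factor outside $\{p_1,\dots,p_d\}$,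 we say that $\psi$ involves only the first $d$ primes; its Bohr lift is then the holomorphic function $\mathcal B\psi(z)=\sum_{n=p_1^{\alpha_1}\cdots p_d^{\alpha_d}}c_n\,z_1^{\alpha_1}\cdots z_d^{\alpha_d}$ on the polydisc $\mathbb D^d$. Theorem. Let $\varphi_j(s)=c_{0,j}s+\psi_j(s)$, $j=1,\dots,N$, be symbols in $\mathcal G$ such that every $\psi_j$ involves only the first $d$ primes. Assume that each $\mathcal B\psi_j$ extends to a function of class $\mathcal C^2$ on $\overline{\mathbb D^d}$ (again denoted by $\mathcal B\psi_j$), and that $\operatorname{char}(\varphi_1)>0$. Let $\lambda_1,\dots,\lambda_N$ be complex numbers such that $\sum_{j=1}^N\lambda_jC_{\varphi_j}$ is a compact operator on $\mathcal H$. Let $z\in\Gamma(\mathcal B\psi_1)=\{w\in\mathbb T^d:\operatorname{Re}\mathcal B\psi_1(w)=0\}$ and let $\mathcal J$ be the set of those $j\in\{1,\dots,N\}$ for which $\mathcal B\psi_j$ and $\mathcal B\psi_1$ have the same second order boundary data at $z$, that is, $\partial_\alpha\mathcal B\psi_j(z)=\partial_\alpha\mathcal B\psi_1(z)$ for all $\alpha\in\mathbb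 N_0^d$ with $|\alpha|\le2$ (including $\alpha=0$). Then $$\sum_{j\in\mathcal J}\lambda_j=0.$$ -/

import Mathlib

open Filter Topology

noncomputable section

/-- The open half-plane `{s : Re s > θ}`. -/
def halfPlane (θ : ℝ) : Set ℂ := {s | θ < s.re}

/-- The Hardy-Hilbert space of Dirichlet series `∑ aₙ n^{-s}` with `∑ |aₙ|² < ∞`, normed by
`‖f‖² = ∑ |aₙ|²`; an element is recorded by its sequence of coefficients. -/
abbrev HardyDirichlet : Type := lp (fun _ : ℕ+ => ℂ) 2

/-- The function `s ↦ ∑ aₙ n^{-s}` defined by an element of the space. The series converges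
absolutely for `Re s > 1/2`, and the function on that half-plane determines the coefficients. -/
def HardyDirichlet.toFun (f : HardyDirichlet) (s : ℂ) : ℂ :=
  ∑' n : ℕ+, f n * ((n : ℕ) : ℂ) ^ (-s)

/-- A symbol of the Gordon-Hedenmalm class, `φ(s) = c₀ s + ψ(s)`, where `ψ` is the sum of the
Dirichlet series with coefficients `coeff`. Only the values of `ψ` on `Re s > 0` are relevant. -/
structure GordonHedenmalm where
  /-- the characteristic -/
  char : ℕ
  /-- the coefficients of the Dirichlet series -/
  coeff : ℕ+ → ℂ
  /-- the sum of the Dirichlet series -/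
  psi : ℂ → ℂ
  tendstoUniformlyOn : ∀ ε : ℝ, 0 < ε →
    TendstoUniformlyOn
      (fun (N : ℕ+) (s : ℂ) => ∑ n ∈ Finset.Icc 1 N, coeff n * ((n : ℕ) : ℂ) ^ (-s))
      psi atTop (halfPlane ε)
  mapsTo : ∀ s ∈ halfPlane (1 / 2), (char : ℂ) * s + psi s ∈ halfPlane (1 / 2)
  mapsTo_of_char_eq_zero : char = 0 → ∀ s ∈ halfPlane 0, psi s ∈ halfPlane (1 / 2)
  mapsTo_of_one_le_char : 1 ≤ char →
    ((∀ s ∈ halfPlane 0, psi s = coeff 1) ∧ 0 ≤ (coeff 1).re) ∨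
      ∀ s ∈ halfPlane 0, psi s ∈ halfPlane 0

/-- The symbol as a function, `φ(s) = c₀ s + ψ(s)`. -/
def GordonHedenmalm.toFun (φ : GordonHedenmalm) (s : ℂ) : ℂ := (φ.char : ℂ) * s + φ.psi s

/-- The function `C_φ f = f ∘ φ` (on `Re s > 1/2`). -/
def GordonHedenmalm.comp (φ : GordonHedenmalm) (f : HardyDirichlet) (s : ℂ) : ℂ :=
  f.toFun (φ.toFun s)

/-- `∑ λⱼ C_{φⱼ}` is (given by) a compact operator on the Hardy-Hilbert space. -/
def IsCompactLinearCombination {N : ℕ} (lam : Fin N → ℂ) (φ : Fin N → GordonHedenmalm) : Prop :=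
  ∃ T : HardyDirichlet →L[ℂ] HardyDirichlet, IsCompactOperator T ∧
    ∀ f : HardyDirichlet, ∀ s ∈ halfPlane (1 / 2),
      (T f).toFun s = ∑ j, lam j * (φ j).comp f s

/-- The `l`-th prime number, counted from `l = 0`. -/
def primeAt (l : ℕ) : ℕ := Nat.nth Nat.Prime l

/-- The Dirichlet series `ψ` involves only the first `d` primes. -/
def GordonHedenmalm.InvolvesOnlyFirst (φ : GordonHedenmalm) (d : ℕ) : Prop :=
  ∀ n : ℕ+, φ.coeff n ≠ 0 → ∀ p : ℕ, p.Prime → p ∣ n → ∃ l : Fin d, p = primeAt l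

/-- The Bohr lift `𝓑ψ(z) = ∑ cₙ z₁^{α₁} ⋯ z_d^{α_d}`, `n = p₁^{α₁} ⋯ p_d^{α_d}`, on the open
polydisc, for a `ψ` which involves only the first `d` primes. -/
def GordonHedenmalm.bohrLift (φ : GordonHedenmalm) (d : ℕ) (z : Fin d → ℂ) : ℂ :=
  ∑' n : ℕ+, φ.coeff n * ∏ l : Fin d, z l ^ (n : ℕ).factorization (primeAt l)

/-- The open polydisc. -/
def openPolydisc (d : ℕ) : Set (Fin d → ℂ) := {z | ∀ l, ‖z l‖ < 1}

/-- The closed polydisc. -/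
def closedPolydisc (d : ℕ) : Set (Fin d → ℂ) := {z | ∀ l, ‖z l‖ ≤ 1}

/-- The polycircle. -/
def polycircle (d : ℕ) : Set (Fin d → ℂ) := {z | ∀ l, ‖z l‖ = 1}

/-- `F` is a `C²` extension to the closed polydisc of the Bohr lift of `ψ`. Here `C²` is meant in
the real sense; `F` is determined by `ψ` on the closed polydisc. -/
def GordonHedenmalm.IsC2BohrLift (φ : GordonHedenmalm) (d : ℕ) (F : (Fin d → ℂ) → ℂ) : Prop :=
  ContDiffOn ℝ 2 F (closedPolydisc d) ∧ Set.EqOn F (φ.bohrLift d) (openPolydisc d)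

/-- `Γ(F)`, the set of points of the polycircle at which `Re F` vanishes. -/
def contactSet {d : ℕ} (F : (Fin d → ℂ) → ℂ) : Set (Fin d → ℂ) :=
  {z | z ∈ polycircle d ∧ (F z).re = 0}

/-- The complex partial derivative `∂F/∂z_l` on the closed polydisc. -/
def partialDeriv {d : ℕ} (l : Fin d) (F : (Fin d → ℂ) → ℂ) (z : Fin d → ℂ) : ℂ :=
  fderivWithin ℂ F (closedPolydisc d) z (Pi.single l 1)

/-- `F` and `G` have the same second order boundary data at `ξ`: all their partial derivatives of
order at most `2` agree there. -/
def SameSecondOrderBoundaryData {d : ℕ} (F G : (Fin d → ℂ) → ℂ) (ξ : Fin d → ℂ) : Prop :=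
  F ξ = G ξ ∧ (∀ l, partialDeriv l F ξ = partialDeriv l G ξ) ∧
    ∀ l m, partialDeriv m (partialDeriv l F) ξ = partialDeriv m (partialDeriv l G) ξ

end

/-! Compactness is tested on normalised kernels built from finitely many primes. Let S be the set of
the first d+2 primes and let |v_p| < 1 for p in S. The sequence n ↦ ∏ v_p^{α_p}, supported on
integers with prime factors in S, has squared norm ∏_S (1 - |v_p|²)⁻¹. The operator maps it to a
Dirichlet series whose Bohr lift is w ↦ ∑_j λ_j ∏_S (1 - v_p w_p^{c_j} p^{-𝓑ψ_j(w)})⁻¹, with c_j the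
characteristics (`tsum_apply_kernel_eq`). The composition formula gives this only on a half-plane of
s; Kronecker's theorem and the identity theorem carry it to the polydisc (`bohr_extension`). Pairing
with a second kernel then evaluates the lift at a point w.

Let w tend to the contact point along w_p = z_p exp(i t u_p - t² log p), t → 0+, with u a real
direction, and let B_j, X_j be the first and second order Taylor coefficients of 𝓑ψ_j along this
curve. Since Re 𝓑ψ_1 ≥ 0 vanishes at z, B_1 is purely imaginary; hence v_p can be chosen with |v_p|
= exp(-t² x log p), x > 0 free, so that it cancels the orders 0 and 1 of w_p^{c_1} p^{-𝓑ψ_1(w)}.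
Multiplied by t^{|S|}, both kernels stay bounded and the second is weakly null, so compactness sends
the pairing to 0. On the other side t²(1 - v_p w_p^{c_j} p^{-𝓑ψ_j(w)})⁻¹ tends to (log p · (x + c_j
+ X_j))⁻¹ for every p if j agrees with 1 in characteristic, value at z and B; any other j has a
factor tending to 0 while the rest stay bounded. Thus ∑ λ_j (x + c_1 + X_j)^{-|S|} = 0 over the
surviving j, for all x > 0 (`sum_rational_eq_zero`), and independence of these functions isolates
the j with X_j = X_1 (`sum_filter_eq_zero_of_rational`).

For generic u, equality of B and X along the curve is equality of all first and second partial
derivatives (`exists_separating_polynomial`). The two primes beyond the first d separate the values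
at z, because log p / log q is irrational, and the characteristics, because u is free there. The
coefficients in J therefore sum to zero within each class of equal characteristic. -/

noncomputable section

/-! ### Completely multiplicative functions and finite Euler products. -/

/-- The completely multiplicative function with prescribed values at the primes. -/
def cmul (v : ℕ → ℂ) : ℕ →*₀ ℂ where
  toFun n := if n = 0 then 0 else n.factorization.prod fun p k => v p ^ k
  map_zero' := by simp
  map_one' := by simp
  map_mul' m n := by
    rcases eq_or_ne m 0 with rfl | hm
    · simp
    rcases eq_or_ne n 0 with rfl | hn
    · simp
    simp only [mul_eq_zero, hm, hn, or_self, if_false]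
    rw [Nat.factorization_mul hm hn, Finsupp.prod_add_index']
    · simp
    · intro p a b; exact pow_add _ _ _

theorem cmul_apply {v : ℕ → ℂ} {n : ℕ} (hn : n ≠ 0) :
    cmul v n = n.factorization.prod fun p k => v p ^ k := if_neg hn

theorem cmul_prime {v : ℕ → ℂ} {p : ℕ} (hp : p.Prime) : cmul v p = v p := by
  rw [cmul_apply hp.ne_zero, hp.factorization]
  simp

theorem cmul_congr {v w : ℕ → ℂ} {n : ℕ} (h : ∀ p, p.Prime → p ∣ n → v p = w p) :
    cmul v n = cmul w n := by
  rcases eq_or_ne n 0 with rfl | hn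
  · simp
  rw [cmul_apply hn, cmul_apply hn]
  refine Finsupp.prod_congr fun p hp => ?_
  rw [Nat.support_factorization, Nat.mem_primeFactors] at hp
  rw [h p hp.1 hp.2.1]

theorem cmul_mul_apply (v w : ℕ → ℂ) (n : ℕ) :
    cmul (fun p => v p * w p) n = cmul v n * cmul w n := by
  rcases eq_or_ne n 0 with rfl | hn
  · simp
  simp only [cmul_apply hn, mul_pow, Finsupp.prod_mul]

theorem cmul_conj (v : ℕ → ℂ) (n : ℕ) :
    cmul (fun p => (starRingEnd ℂ) (v p)) n = (starRingEnd ℂ) (cmul v n) := by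
  rcases eq_or_ne n 0 with rfl | hn
  · simp
  simp only [cmul_apply hn, Finsupp.prod, map_prod, map_pow]

theorem norm_cmul (v : ℕ → ℂ) (n : ℕ) :
    cmul (fun p => (‖v p‖ : ℂ)) n = (‖cmul v n‖ : ℂ) := by
  rcases eq_or_ne n 0 with rfl | hn
  · simp
  simp only [cmul_apply hn, Finsupp.prod, norm_prod, norm_pow, Complex.ofReal_prod,
    Complex.ofReal_pow]

theorem norm_cmul_le_norm_cmul {v w : ℕ → ℂ} {n : ℕ}
    (h : ∀ p, p.Prime → p ∣ n → ‖v p‖ ≤ ‖w p‖) : ‖cmul v n‖ ≤ ‖cmul w n‖ := by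
  rcases eq_or_ne n 0 with rfl | hn
  · simp
  simp only [cmul_apply hn, Finsupp.prod, norm_prod, norm_pow]
  refine Finset.prod_le_prod (fun _ _ => by positivity) fun p hp => ?_
  rw [Nat.support_factorization, Nat.mem_primeFactors] at hp
  exact pow_le_pow_left₀ (norm_nonneg _) (h p hp.1 hp.2.1) _

theorem cmul_const_one {n : ℕ} (hn : n ≠ 0) : cmul (fun _ => 1) n = 1 := by
  rw [cmul_apply hn]; simp [Finsupp.prod]

theorem cmul_eq_zero {v : ℕ → ℂ} {n p : ℕ} (hp : p.Prime) (hpn : p ∣ n) (hv : v p = 0) :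
    cmul v n = 0 := by
  obtain ⟨m, rfl⟩ := hpn
  rw [map_mul, cmul_prime hp, hv, zero_mul]

theorem cmul_cpow {n : ℕ} (hn : n ≠ 0) (s : ℂ) :
    cmul (fun p => (p : ℂ) ^ s) n = (n : ℂ) ^ s := by
  induction n using Nat.recOnMul with
  | zero => exact absurd rfl hn
  | one => simp
  | prime p hp => exact cmul_prime hp
  | mul a b iha ihb =>
    rw [mul_ne_zero_iff] at hn
    rw [map_mul, iha hn.1, ihb hn.2, Nat.cast_mul, Complex.natCast_mul_natCast_cpow]

/-- All the prime factors of `n` belong to `S`. -/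
def IsFactored (S : Finset ℕ) (n : ℕ) : Prop := ∀ p, p.Prime → p ∣ n → p ∈ S

/-- Since `v` vanishes off `S`, only integers with all prime factors in `S` contribute, and their
sum factors into finitely many geometric series. -/
theorem hasSum_cmul {v : ℕ → ℂ} {S : Finset ℕ} (hS : ∀ p ∈ S, p.Prime)
    (hv : ∀ p ∈ S, ‖v p‖ < 1) (hv0 : ∀ p ∉ S, v p = 0) :
    (Summable fun n : ℕ+ => ‖cmul v n‖) ∧
      HasSum (fun n : ℕ+ => cmul v n) (∏ p ∈ S, (1 - v p)⁻¹) := by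
  have hlt : ∀ {p : ℕ}, p.Prime → ‖((cmul v : ℕ →*₀ ℂ) : ℕ →* ℂ) p‖ < 1 := by
    intro p hp
    change ‖cmul v p‖ < 1
    rw [cmul_prime hp]
    by_cases h : p ∈ S
    · exact hv p h
    · rw [hv0 p h]; simp
  obtain ⟨h1, h2⟩ :=
    EulerProduct.summable_and_hasSum_factoredNumbers_prod_filter_prime_geometric hlt S
  have hfil : S.filter Nat.Prime = S := Finset.filter_true_of_mem hS
  rw [hfil] at h2
  have h3 : ∏ p ∈ S, (1 - ((cmul v : ℕ →*₀ ℂ) : ℕ →* ℂ) p)⁻¹ = ∏ p ∈ S, (1 - v p)⁻¹ :=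
    Finset.prod_congr rfl fun p hp => by
      change (1 - cmul v p)⁻¹ = _
      rw [cmul_prime (hS p hp)]
  rw [h3] at h2
  have hsupp : ∀ n : ℕ, n ∉ Nat.factoredNumbers S → cmul v n = 0 := by
    intro n hn
    rcases eq_or_ne n 0 with rfl | hn0
    · simp
    rw [Nat.mem_factoredNumbers'] at hn
    push Not at hn
    obtain ⟨p, hp, hpn, hpS⟩ := hn
    exact cmul_eq_zero hp hpn (hv0 p hpS)
  have hinj : Function.Injective (fun n : ℕ+ => (n : ℕ)) := PNat.coe_injective
  have hrange : ∀ n : ℕ, n ∉ Set.range (fun n : ℕ+ => (n : ℕ)) → n = 0 := by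
    intro n hn
    by_contra h
    exact hn ⟨⟨n, Nat.pos_of_ne_zero h⟩, rfl⟩
  constructor
  · have : Summable fun n : ℕ => ‖cmul v n‖ := by
      rw [← Function.Injective.summable_iff (g := ((↑) : Nat.factoredNumbers S → ℕ))
        Subtype.val_injective]
      · exact h1
      · intro n hn
        rw [Subtype.range_coe] at hn
        rw [hsupp n hn, norm_zero]
    exact this.comp_injective hinj
  · refine (hinj.hasSum_iff (f := fun n : ℕ => cmul v n)
      (fun n hn => by rw [hrange n hn]; simp)).2 ?_
    exact (hasSum_subtype_iff_of_support_subset (s := Nat.factoredNumbers S)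
      (f := fun n : ℕ => cmul v n) fun n hn => by
        by_contra h
        exact hn (hsupp n h)).1 h2

/-! ### Mean values on the half-line and Kronecker's theorem for logarithms of primes. -/

/-- The mean value of `g` along the positive half-line is `m`. -/
def HasMean (g : ℝ → ℂ) (m : ℂ) : Prop :=
  Continuous g ∧ Tendsto (fun T : ℝ => (T : ℂ)⁻¹ * ∫ t in (0 : ℝ)..T, g t) atTop (𝓝 m)

theorem HasMean.const_mul {g : ℝ → ℂ} {m : ℂ} (h : HasMean g m) (c : ℂ) :
    HasMean (fun t => c * g t) (c * m) := by
  refine ⟨continuous_const.mul h.1, ?_⟩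
  refine (h.2.const_mul c).congr fun T => ?_
  rw [intervalIntegral.integral_const_mul]; ring

theorem HasMean.sub {g h : ℝ → ℂ} {m k : ℂ} (hg : HasMean g m) (hh : HasMean h k) :
    HasMean (fun t => g t - h t) (m - k) := by
  refine ⟨hg.1.sub hh.1, ?_⟩
  refine (hg.2.sub hh.2).congr fun T => ?_
  rw [intervalIntegral.integral_sub (hg.1.intervalIntegrable _ _) (hh.1.intervalIntegrable _ _)]
  ring

theorem HasMean.sum {ι : Type*} {s : Finset ι} {g : ι → ℝ → ℂ} {m : ι → ℂ}
    (h : ∀ i ∈ s, HasMean (g i) (m i)) :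
    HasMean (fun t => ∑ i ∈ s, g i t) (∑ i ∈ s, m i) := by
  refine ⟨continuous_finsetSum _ fun i hi => (h i hi).1, ?_⟩
  refine (tendsto_finsetSum s fun i hi => (h i hi).2).congr fun T => ?_
  rw [intervalIntegral.integral_finsetSum fun i hi => (h i hi).1.intervalIntegrable _ _,
    Finset.mul_sum]

theorem HasMean.re_nonneg {g : ℝ → ℂ} {m : ℂ} (h : HasMean g m) (hg : ∀ t, 0 ≤ (g t).re) :
    0 ≤ m.re := by
  refine ge_of_tendsto ((Complex.continuous_re.tendsto _).comp h.2) ?_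
  filter_upwards [eventually_gt_atTop 0] with T hT
  have h1 : (∫ t in (0 : ℝ)..T, g t).re = ∫ t in (0 : ℝ)..T, (g t).re := by
    have := intervalIntegral.intervalIntegral_re (𝕜 := ℂ) (μ := MeasureTheory.volume)
      (h.1.intervalIntegrable 0 T)
    simpa using this.symm
  have h2 : 0 ≤ ∫ t in (0 : ℝ)..T, (g t).re :=
    intervalIntegral.integral_nonneg hT.le fun t _ => hg t
  simp only [Function.comp]
  rw [← Complex.ofReal_inv, Complex.re_ofReal_mul, h1]
  positivity

theorem hasMean_one : HasMean (fun _ => 1) 1 := by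
  refine ⟨continuous_const, tendsto_const_nhds.congr' ?_⟩
  filter_upwards [eventually_gt_atTop 0] with T hT
  have : (T : ℂ) ≠ 0 := by exact_mod_cast hT.ne'
  simp [this]

theorem hasMean_exp {μ : ℝ} (hμ : μ ≠ 0) :
    HasMean (fun t : ℝ => Complex.exp ((μ * Complex.I) * t)) 0 := by
  have hc : (μ : ℂ) * Complex.I ≠ 0 := by simp [hμ]
  refine ⟨by fun_prop, ?_⟩
  rw [tendsto_zero_iff_norm_tendsto_zero]
  have h0 : Tendsto (fun T : ℝ => T⁻¹ * (2 / |μ|)) atTop (𝓝 0) := by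
    simpa using tendsto_inv_atTop_zero.mul_const (2 / |μ|)
  refine squeeze_zero' (Eventually.of_forall fun _ => norm_nonneg _) ?_ h0
  filter_upwards [eventually_gt_atTop 0] with T hT
  rw [integral_exp_mul_complex hc, norm_mul, norm_inv, Complex.norm_real, Real.norm_eq_abs,
    abs_of_pos hT, norm_div]
  have h1 : ‖(μ : ℂ) * Complex.I‖ = |μ| := by simp
  have hn : ∀ x : ℝ, ‖Complex.exp (μ * Complex.I * x)‖ = 1 := fun x => by
    rw [Complex.norm_exp]; simp
  rw [h1]
  gcongr
  calc _ ≤ ‖Complex.exp (μ * Complex.I * T)‖ + ‖Complex.exp (μ * Complex.I * (0 : ℝ))‖ :=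
        norm_sub_le _ _
    _ = 2 := by rw [hn, hn]; norm_num

/-- Finite sets of integers which are almost invariant under multiplication by given primes. -/
theorem exists_almost_invariant (P : Finset ℕ) (hP : ∀ p ∈ P, p.Prime) (N : ℕ) (hN : 0 < N) :
    ∃ E : Finset ℕ, E.Nonempty ∧ (∀ n ∈ E, n ≠ 0 ∧ IsFactored P n) ∧
      ∀ p ∈ P, N * (E.filter fun n => p * n ∉ E).card ≤ E.card := by
  induction P using Finset.induction with
  | empty =>
    refine ⟨{1}, by simp, ?_, by simp⟩
    intro n hn
    rw [Finset.mem_singleton] at hn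
    subst hn
    exact ⟨one_ne_zero, fun p hp h => absurd (Nat.dvd_one.1 h) hp.ne_one⟩
  | insert q P hq ih =>
    obtain ⟨E, hne, hE, hinv⟩ := ih fun p hp => hP p (Finset.mem_insert_of_mem hp)
    have hqp : q.Prime := hP q (Finset.mem_insert_self _ _)
    -- A box of exponents: multiplication by `q` leaves the new set only from the top layer `k = N -
    -- 1`, a proportion 1/N, while the other primes act on the factor `E` alone.
    let f : ℕ × ℕ → ℕ := fun x => q ^ x.1 * x.2
    have hqn : ∀ n ∈ E, ¬ q ∣ n := fun n hn h => hq ((hE n hn).2 q hqp h)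
    have hinj : Set.InjOn f (Finset.range N ×ˢ E : Finset (ℕ × ℕ)) := by
      rintro ⟨k, n⟩ h1 ⟨l, m⟩ h2 h
      simp only [Finset.coe_product, Set.mem_prod, Finset.mem_coe] at h1 h2
      simp only [f] at h
      have hk : ∀ k n, n ∈ E → (q ^ k * n).factorization q = k := by
        intro k n hn
        rw [Nat.factorization_mul (pow_ne_zero _ hqp.ne_zero) (hE n hn).1]
        simp [hqp.factorization_self, Nat.factorization_eq_zero_of_not_dvd (hqn n hn)]
      have hkl : k = l := by rw [← hk k n h1.2, h, hk l m h2.2]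
      subst hkl
      rw [Nat.eq_of_mul_eq_mul_left (pow_pos hqp.pos k) h]
    refine ⟨(Finset.range N ×ˢ E).image f, ?_, ?_, ?_⟩
    · exact ((Finset.nonempty_range_iff.2 hN.ne').product hne).image f
    · intro n hn
      obtain ⟨⟨k, m⟩, hkm, rfl⟩ := Finset.mem_image.1 hn
      rw [Finset.mem_product] at hkm
      refine ⟨mul_ne_zero (pow_ne_zero _ hqp.ne_zero) (hE m hkm.2).1, fun p hp h => ?_⟩
      rcases (Nat.Prime.dvd_mul hp).1 h with h | h
      · rw [(Nat.prime_dvd_prime_iff_eq hp hqp).1 (hp.dvd_of_dvd_pow h)]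
        exact Finset.mem_insert_self _ _
      · exact Finset.mem_insert_of_mem ((hE m hkm.2).2 p hp h)
    · rw [Finset.card_image_of_injOn hinj, Finset.card_product, Finset.card_range]
      intro p hp
      refine Nat.mul_le_mul_left N ?_
      rcases eq_or_ne p q with rfl | hpq
      · calc _ ≤ (({N - 1} ×ˢ E : Finset (ℕ × ℕ)).image f).card := by
              refine Finset.card_le_card fun n hn => ?_
              rw [Finset.mem_filter, Finset.mem_image] at hn
              obtain ⟨⟨⟨k, m⟩, hkm, rfl⟩, hn⟩ := hn
              rw [Finset.mem_product, Finset.mem_range] at hkm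
              refine Finset.mem_image.2 ⟨⟨k, m⟩, ?_, rfl⟩
              rw [Finset.mem_product, Finset.mem_singleton]
              refine ⟨?_, hkm.2⟩
              by_contra hk
              refine hn (Finset.mem_image.2 ⟨⟨k + 1, m⟩, ?_, ?_⟩)
              · rw [Finset.mem_product, Finset.mem_range]
                have := hkm.1
                simp only at this hk ⊢
                exact ⟨by omega, hkm.2⟩
              · simp only [f]; ring
          _ ≤ _ := Finset.card_image_le
          _ = _ := by simp
      · have hpP : p ∈ P := (Finset.mem_insert.1 hp).resolve_left hpq
        calc _ ≤ ((Finset.range N ×ˢ (E.filter fun n => p * n ∉ E)).image f).card := by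
              refine Finset.card_le_card fun n hn => ?_
              rw [Finset.mem_filter, Finset.mem_image] at hn
              obtain ⟨⟨⟨k, m⟩, hkm, rfl⟩, hn⟩ := hn
              rw [Finset.mem_product] at hkm
              refine Finset.mem_image.2 ⟨⟨k, m⟩, ?_, rfl⟩
              rw [Finset.mem_product, Finset.mem_filter]
              refine ⟨hkm.1, hkm.2, fun h => hn ?_⟩
              refine Finset.mem_image.2 ⟨⟨k, p * m⟩, Finset.mem_product.2 ⟨hkm.1, h⟩, ?_⟩
              simp only [f]; ring
          _ ≤ _ := Finset.card_image_le
          _ = N * (E.filter fun n => p * n ∉ E).card := by simp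
          _ ≤ _ := hinv p hpP

theorem norm_cmul_eq_one {v : ℕ → ℂ} {n : ℕ} (hn : n ≠ 0)
    (h : ∀ p, p.Prime → p ∣ n → ‖v p‖ = 1) : ‖cmul v n‖ = 1 := by
  rw [cmul_apply hn, Finsupp.prod, norm_prod]
  refine Finset.prod_eq_one fun p hp => ?_
  rw [Nat.support_factorization, Nat.mem_primeFactors] at hp
  rw [norm_pow, h p hp.1 hp.2.1, one_pow]

theorem natCast_cpow_neg_mul_I {n : ℕ} (hn : n ≠ 0) (t : ℝ) :
    (n : ℂ) ^ (-(t * Complex.I)) = Complex.exp (-(Real.log n * Complex.I) * t) := by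
  rw [Complex.cpow_def_of_ne_zero (by exact_mod_cast hn), Complex.natCast_log]
  congr 1; ring

/-- For `m ≠ n` the product is a constant times an exponential of frequency log n - log m ≠ 0, so
its mean vanishes: the characters attached to distinct integers are orthogonal. -/
theorem hasMean_cmul_mul_conj {χ : ℕ → ℂ} {m n : ℕ} (hm : m ≠ 0) (hn : n ≠ 0)
    (hχ : ∀ p, p.Prime → p ∣ m → ‖χ p‖ = 1) :
    HasMean (fun t : ℝ => cmul (fun p => χ p * (p : ℂ) ^ (-(t * Complex.I))) m *
        (starRingEnd ℂ) (cmul (fun p => χ p * (p : ℂ) ^ (-(t * Complex.I))) n))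
      (if m = n then 1 else 0) := by
  split_ifs with h
  · subst h
    convert hasMean_one using 2 with t
    rw [Complex.mul_conj, Complex.normSq_eq_norm_sq, norm_cmul_eq_one hm]
    · simp
    · intro p hp hpm
      rw [norm_mul, hχ p hp hpm, Complex.norm_natCast_cpow_of_pos hp.pos]
      simp
  · have hlog : Real.log n - Real.log m ≠ 0 := by
      rw [sub_ne_zero]
      intro h'
      have := Real.log_injOn_pos (Set.mem_Ioi.2 (by positivity : (0 : ℝ) < n))
        (Set.mem_Ioi.2 (by positivity : (0 : ℝ) < m)) h'
      exact h (by exact_mod_cast this.symm)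
    convert (hasMean_exp hlog).const_mul (cmul χ m * (starRingEnd ℂ) (cmul χ n)) using 2 with t
    · rw [cmul_mul_apply, cmul_mul_apply, cmul_cpow hm, cmul_cpow hn, natCast_cpow_neg_mul_I hm,
        natCast_cpow_neg_mul_I hn, map_mul, ← Complex.exp_conj, mul_mul_mul_comm,
        ← Complex.exp_add]
      congr 2
      simp only [map_mul, map_neg, Complex.conj_ofReal, Complex.conj_I, Complex.ofReal_sub]
      ring
    · simp

/-- Kronecker's theorem for the logarithms of primes. -/
theorem exists_norm_natCast_cpow_sub_lt (P : Finset ℕ) (hP : ∀ p ∈ P, p.Prime) (χ : ℕ → ℂ)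
    (hχ : ∀ p ∈ P, ‖χ p‖ = 1) {δ : ℝ} (hδ : 0 < δ) :
    ∃ t : ℝ, ∀ p ∈ P, ‖(p : ℂ) ^ (-(t * Complex.I)) - χ p‖ < δ := by
  by_contra! hcon
  set x : ℝ → ℕ → ℂ := fun t p => (starRingEnd ℂ) (χ p) * (p : ℂ) ^ (-(t * Complex.I)) with hx
  have hx1 : ∀ t : ℝ, ∀ p ∈ P, ‖x t p‖ = 1 := by
    intro t p hp
    rw [hx]
    simp only
    rw [norm_mul, RCLike.norm_conj, hχ p hp, Complex.norm_natCast_cpow_of_pos (hP p hp).pos]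
    simp
  have hre : ∀ t : ℝ, ∀ p ∈ P, ‖(p : ℂ) ^ (-(t * Complex.I)) - χ p‖ ^ 2 = 2 * (1 - (x t p).re) := by
    intro t p hp
    have h1 : (p : ℂ) ^ (-(t * Complex.I)) - χ p = χ p * (x t p - 1) := by
      have : χ p * (starRingEnd ℂ) (χ p) = 1 := by
        rw [Complex.mul_conj, Complex.normSq_eq_norm_sq, hχ p hp]; simp
      rw [hx]; simp only
      linear_combination (-(p : ℂ) ^ (-(t * Complex.I))) * this
    have h2 := hx1 t p hp
    rw [h1, norm_mul, hχ p hp, one_mul, ← Complex.normSq_eq_norm_sq, Complex.normSq_apply]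
    have h3 : Complex.normSq (x t p) = 1 := by rw [Complex.normSq_eq_norm_sq, h2]; simp
    rw [Complex.normSq_apply] at h3
    simp only [Complex.sub_re, Complex.sub_im, Complex.one_re, Complex.one_im]
    nlinarith
  have hre0 : ∀ t, ∀ p ∈ P, 0 ≤ 1 - (x t p).re := by
    intro t p hp
    nlinarith [hre t p hp, sq_nonneg ‖(p : ℂ) ^ (-(t * Complex.I)) - χ p‖]
  have hlow : ∀ t, δ ^ 2 / 2 ≤ ∑ p ∈ P, (1 - (x t p).re) := by
    intro t
    obtain ⟨p, hp, h⟩ := hcon t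
    calc δ ^ 2 / 2 ≤ 1 - (x t p).re := by
          have := pow_le_pow_left₀ hδ.le h 2
          rw [hre t p hp] at this; linarith
      _ ≤ _ := Finset.single_le_sum (f := fun p => 1 - (x t p).re) (hre0 t) hp
  obtain ⟨N, hN⟩ := exists_nat_gt (P.card / (δ ^ 2 / 2))
  have hN0 : 0 < N := by
    have : (0 : ℝ) < N := lt_of_le_of_lt (by positivity) hN
    exact_mod_cast this
  obtain ⟨E, hne, hE, hinv⟩ := exists_almost_invariant P hP N hN0
  -- |A|² is a Fejér-type weight: its mean is the cardinality of `E`, and its correlation with `x t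
  -- p` counts the `n ∈ E` with `p * n ∈ E`.
  let A : ℝ → ℂ := fun t => ∑ n ∈ E, cmul (x t) n
  have hmean : ∀ m, m ≠ 0 → IsFactored P m → ∀ n ∈ E,
      HasMean (fun t => cmul (x t) m * (starRingEnd ℂ) (cmul (x t) n)) (if m = n then 1 else 0) := by
    intro m hm0 hm n hn
    refine hasMean_cmul_mul_conj hm0 (hE n hn).1 fun p hp hpm => ?_
    rw [RCLike.norm_conj, hχ p (hm p hp hpm)]
  have hM0 : HasMean (fun t => A t * (starRingEnd ℂ) (A t)) (E.card) := by
    have := HasMean.sum fun m (hm : m ∈ E) => HasMean.sum fun n (hn : n ∈ E) =>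
      hmean m (hE m hm).1 (hE m hm).2 n hn
    convert this using 2 with t
    · simp only [A, map_sum, Finset.sum_mul_sum]
    · simp
  have hMp : ∀ p ∈ P, HasMean (fun t => x t p * (A t * (starRingEnd ℂ) (A t)))
      ((E.filter fun n => p * n ∈ E).card) := by
    intro p hp
    have := HasMean.sum fun m (hm : m ∈ E) => HasMean.sum fun n (hn : n ∈ E) =>
      hmean (p * m) (mul_ne_zero (hP p hp).ne_zero (hE m hm).1) (fun q hq h => by
        rcases (Nat.Prime.dvd_mul hq).1 h with h | h
        · rwa [(Nat.prime_dvd_prime_iff_eq hq (hP p hp)).1 h]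
        · exact (hE m hm).2 q hq h) n hn
    convert this using 2 with t
    · simp only [A, map_sum, Finset.sum_mul_sum]
      simp only [Finset.mul_sum, map_mul, cmul_prime (hP p hp), mul_assoc]
    · simp
  -- If Kronecker's theorem failed, ∑ (1 - Re x_p) would be at least δ²/2 for all t. Averaged
  -- against |A|² this contradicts almost invariance, which bounds the mean by |P||E|/N with N >
  -- |P|/(δ²/2).
  have hM := (HasMean.sum fun p (hp : p ∈ P) => hM0.sub (hMp p hp)).sub
    (hM0.const_mul ((δ ^ 2 / 2 : ℝ) : ℂ))
  have hnn := hM.re_nonneg fun t => by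
    have hA : A t * (starRingEnd ℂ) (A t) = ((‖A t‖ ^ 2 : ℝ) : ℂ) := by
      rw [Complex.mul_conj, Complex.normSq_eq_norm_sq]
    rw [hA, Complex.sub_re, Complex.re_sum, ← Complex.ofReal_mul, Complex.ofReal_re]
    have : ∀ p ∈ P, (((‖A t‖ ^ 2 : ℝ) : ℂ) - x t p * ((‖A t‖ ^ 2 : ℝ) : ℂ)).re =
        (1 - (x t p).re) * ‖A t‖ ^ 2 := fun p hp => by
      rw [Complex.sub_re, Complex.re_mul_ofReal, Complex.ofReal_re]; ring
    rw [Finset.sum_congr rfl this, ← Finset.sum_mul, ← sub_mul]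
    exact mul_nonneg (sub_nonneg.2 (hlow t)) (by positivity)
  have hle : ∀ p ∈ P, (((E.card : ℂ) - ((E.filter fun n => p * n ∈ E).card : ℂ))).re ≤
      E.card / N := by
    intro p hp
    have h1 := Finset.card_filter_add_card_filter_not (s := E) (fun n => p * n ∈ E)
    have h2 := hinv p hp
    rw [le_div_iff₀ (by exact_mod_cast hN0)]
    have h1' : ((E.filter fun n => p * n ∈ E).card : ℝ) + (E.filter fun n => p * n ∉ E).card =
        E.card := by exact_mod_cast h1
    have h2' : (N : ℝ) * (E.filter fun n => p * n ∉ E).card ≤ E.card := by exact_mod_cast h2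
    simp only [Complex.sub_re, Complex.natCast_re]
    nlinarith
  rw [Complex.sub_re, Complex.re_sum, Complex.re_ofReal_mul, Complex.natCast_re] at hnn
  have h3 := Finset.sum_le_sum hle
  rw [Finset.sum_const, nsmul_eq_mul] at h3
  have hEpos : (0 : ℝ) < E.card := by exact_mod_cast hne.card_pos
  have hNpos : (0 : ℝ) < N := by exact_mod_cast hN0
  have h4 : (P.card : ℝ) < δ ^ 2 / 2 * N := by
    rw [div_lt_iff₀ (by positivity)] at hN; linarith
  have h5 : (P.card : ℝ) * (E.card / N) < δ ^ 2 / 2 * E.card := by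
    rw [mul_div_assoc', div_lt_iff₀ hNpos]
    nlinarith
  linarith

/-! ### The infinite torus and its dense flow. -/

/-- A family of unimodular numbers indexed by the primes, as a function on `ℕ`. -/
def primeExt (χ : Nat.Primes → Circle) (p : ℕ) : ℂ := if h : p.Prime then χ ⟨p, h⟩ else 0

theorem primeExt_of_prime (χ : Nat.Primes → Circle) {p : ℕ} (hp : p.Prime) :
    primeExt χ p = χ ⟨p, hp⟩ := dif_pos hp

theorem norm_primeExt (χ : Nat.Primes → Circle) {p : ℕ} (hp : p.Prime) : ‖primeExt χ p‖ = 1 := by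
  rw [primeExt_of_prime χ hp, Circle.norm_coe]

theorem continuous_primeExt (p : ℕ) : Continuous fun χ : Nat.Primes → Circle => primeExt χ p := by
  by_cases hp : p.Prime
  · simp only [primeExt_of_prime _ hp]
    exact continuous_subtype_val.comp (continuous_apply _)
  · simp only [primeExt, hp, dite_false]
    exact continuous_const

theorem continuous_cmul_comp {X : Type*} [TopologicalSpace X] {f : X → ℕ → ℂ}
    (hf : ∀ p, Continuous fun x => f x p) (n : ℕ) : Continuous fun x => cmul (f x) n := by
  rcases eq_or_ne n 0 with rfl | hn
  · simp only [map_zero]; exact continuous_const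
  · simp only [cmul_apply hn, Finsupp.prod]
    exact continuous_finsetProd _ fun p _ => (hf p).pow _

/-- The point `(p^{-it})_p` of the infinite torus. -/
def primeFlow (t : ℝ) (p : Nat.Primes) : Circle := Circle.exp (-(t * Real.log (p : ℕ)))

theorem primeExt_primeFlow (t : ℝ) {p : ℕ} (hp : p.Prime) :
    primeExt (primeFlow t) p = (p : ℂ) ^ (-(t * Complex.I)) := by
  rw [primeExt_of_prime _ hp, natCast_cpow_neg_mul_I hp.ne_zero]
  change ((Circle.exp (-(t * Real.log p)) : Circle) : ℂ) = _
  rw [Circle.coe_exp]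
  congr 1
  push_cast
  ring

/-- A basic open set of the product constrains finitely many primes only, which is the case covered
by Kronecker's theorem. -/
theorem denseRange_primeFlow : DenseRange primeFlow := by
  intro χ
  rw [mem_closure_iff]
  intro o ho hχo
  rw [isOpen_pi_iff] at ho
  obtain ⟨I, u, hu, hIu⟩ := ho χ hχo
  have hδ : ∃ δ > 0, ∀ p ∈ I, ∀ c : Circle, ‖(c : ℂ) - χ p‖ < δ → c ∈ u p := by
    clear hIu
    induction I using Finset.induction with
    | empty => exact ⟨1, one_pos, by simp⟩
    | insert q I hq ih =>
      obtain ⟨δ, hδ, h⟩ := ih fun a ha => hu a (Finset.mem_insert_of_mem ha)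
      have hq' := hu q (Finset.mem_insert_self _ _)
      obtain ⟨δ', hδ', h'⟩ := Metric.isOpen_iff.1 hq'.1 _ hq'.2
      refine ⟨min δ δ', lt_min hδ hδ', fun p hp c hc => ?_⟩
      rcases Finset.mem_insert.1 hp with rfl | hp
      · refine h' ?_
        have hd : dist c (χ p) = ‖(c : ℂ) - χ p‖ := by
          rw [← dist_eq_norm]; rfl
        rw [Metric.mem_ball, hd]
        exact hc.trans_le (min_le_right _ _)
      · exact h p hp c (hc.trans_le (min_le_left _ _))
  obtain ⟨δ, hδ, h⟩ := hδ
  obtain ⟨t, ht⟩ := exists_norm_natCast_cpow_sub_lt (I.map ⟨fun p : Nat.Primes => (p : ℕ),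
    Subtype.val_injective⟩) (by
      intro p hp
      obtain ⟨q, _, rfl⟩ := Finset.mem_map.1 hp
      exact q.2) (primeExt χ) (by
      intro p hp
      obtain ⟨q, _, rfl⟩ := Finset.mem_map.1 hp
      exact norm_primeExt χ q.2) hδ
  refine ⟨primeFlow t, hIu fun p hp => h p hp _ ?_, t, rfl⟩
  have := ht p (Finset.mem_map.2 ⟨p, hp, rfl⟩)
  rwa [← primeExt_primeFlow t p.2, primeExt_of_prime _ p.2, primeExt_of_prime _ p.2] at this

/-- The point `(p^{-σ} χ_p)_p`. -/
def torusPoint (σ : ℝ) (χ : Nat.Primes → Circle) (p : ℕ) : ℂ :=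
  (p : ℂ) ^ (-(σ : ℂ)) * primeExt χ p

theorem torusPoint_primeFlow (σ t : ℝ) {p : ℕ} (hp : p.Prime) :
    torusPoint σ (primeFlow t) p = (p : ℂ) ^ (-(σ + t * Complex.I)) := by
  rw [torusPoint, primeExt_primeFlow t hp, ← Complex.cpow_add _ _ (by exact_mod_cast hp.ne_zero)]
  congr 1
  ring

theorem norm_torusPoint (σ : ℝ) (χ : Nat.Primes → Circle) {p : ℕ} (hp : p.Prime) :
    ‖torusPoint σ χ p‖ = (p : ℝ) ^ (-σ) := by
  rw [torusPoint, norm_mul, norm_primeExt χ hp, Complex.norm_natCast_cpow_of_pos hp.pos]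
  simp

theorem continuous_torusPoint (σ : ℝ) (p : ℕ) :
    Continuous fun χ : Nat.Primes → Circle => torusPoint σ χ p :=
  continuous_const.mul (continuous_primeExt p)

theorem norm_cmul_torusPoint (σ : ℝ) (χ : Nat.Primes → Circle) {n : ℕ} (hn : n ≠ 0) :
    ‖cmul (torusPoint σ χ) n‖ = (n : ℝ) ^ (-σ) := by
  have h : cmul (torusPoint σ χ) n = (n : ℂ) ^ (-(σ : ℂ)) * cmul (primeExt χ) n := by
    rw [← cmul_cpow hn, ← cmul_mul_apply]; rfl
  rw [h, norm_mul, norm_cmul_eq_one hn fun p hp _ => norm_primeExt χ hp,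
    Complex.norm_natCast_cpow_of_pos (Nat.pos_of_ne_zero hn)]
  simp

theorem cmul_torusPoint_primeFlow (σ t : ℝ) {n : ℕ} (hn : n ≠ 0) :
    cmul (torusPoint σ (primeFlow t)) n = (n : ℂ) ^ (-(σ + t * Complex.I)) := by
  rw [← cmul_cpow hn]
  exact cmul_congr fun p hp _ => torusPoint_primeFlow σ t hp

/-! ### Dirichlet series over finitely many primes. -/

/-- Coefficients supported on the integers with prime factors in `S`, of growth `O(n^σ)` for
every `σ > 0`. -/
structure IsModerate (S : Finset ℕ) (a : ℕ+ → ℂ) : Prop where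
  factored : ∀ n : ℕ+, a n ≠ 0 → IsFactored S n
  growth : ∀ σ : ℝ, 0 < σ → ∃ C : ℝ, ∀ n : ℕ+, ‖a n‖ ≤ C * (n : ℝ) ^ σ

theorem norm_cpow_neg_lt_one {p : ℕ} (hp : p.Prime) {s : ℂ} (hs : 0 < s.re) :
    ‖(p : ℂ) ^ (-s)‖ < 1 := by
  rw [Complex.norm_natCast_cpow_of_pos hp.pos]
  exact Real.rpow_lt_one_of_one_lt_of_neg (by exact_mod_cast hp.one_lt) (by simpa using hs)

/-- Half of the decay n^{-σ} absorbs the growth of the coefficients. The remaining n^{-σ/2} is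
summable for every σ > 0 because only finitely many primes occur: it is a finite Euler product. -/
theorem IsModerate.exists_summable_bound {S : Finset ℕ} (hS : ∀ p ∈ S, p.Prime) {a : ℕ+ → ℂ}
    (ha : IsModerate S a) {σ : ℝ} (hσ : 0 < σ) :
    ∃ u : ℕ+ → ℝ, Summable u ∧ ∀ v : ℕ → ℂ, (∀ p ∈ S, ‖v p‖ ≤ (p : ℝ) ^ (-σ)) →
      ∀ n : ℕ+, ‖a n * cmul v n‖ ≤ u n := by
  obtain ⟨C, hC⟩ := ha.growth (σ / 2) (by positivity)
  have hC0 : 0 ≤ C := by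
    have := (norm_nonneg _).trans (hC 1)
    simpa using this
  set v₀ : ℕ → ℂ := fun p => if p ∈ S then (p : ℂ) ^ (-((σ / 2 : ℝ) : ℂ)) else 0 with hv₀
  have hsum := (hasSum_cmul (v := v₀) hS (fun p hp => by
    rw [hv₀]; simp only [hp, if_true]
    exact norm_cpow_neg_lt_one (hS p hp) (by simpa using hσ)) (fun p hp => by
    rw [hv₀]; simp only [hp, if_false])).1
  refine ⟨fun n => C * ‖cmul v₀ n‖, hsum.mul_left C, fun v hv n => ?_⟩
  by_cases hn : a n = 0
  · rw [hn, zero_mul, norm_zero]; positivity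
  have hfac := ha.factored n hn
  have hnpos : (0 : ℝ) < (n : ℕ) := by exact_mod_cast n.pos
  have h1 : ‖cmul v₀ n‖ = ((n : ℕ) : ℝ) ^ (-(σ / 2)) := by
    rw [cmul_congr (w := fun p => (p : ℂ) ^ (-((σ / 2 : ℝ) : ℂ))) fun p hp hpn => by
      rw [hv₀]; simp only [hfac p hp hpn, if_true], cmul_cpow n.ne_zero,
      Complex.norm_natCast_cpow_of_pos n.pos]
    simp
  have h2 : ‖cmul v n‖ ≤ ((n : ℕ) : ℝ) ^ (-σ) := by
    have : ‖cmul v n‖ ≤ ‖cmul (fun p => (p : ℂ) ^ (-(σ : ℂ))) n‖ :=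
      norm_cmul_le_norm_cmul fun p hp hpn => by
        rw [Complex.norm_natCast_cpow_of_pos hp.pos]
        simpa using hv p (hfac p hp hpn)
    rw [cmul_cpow n.ne_zero, Complex.norm_natCast_cpow_of_pos n.pos] at this
    simpa using this
  calc ‖a n * cmul v n‖ = ‖a n‖ * ‖cmul v n‖ := norm_mul _ _
    _ ≤ (C * ((n : ℕ) : ℝ) ^ (σ / 2)) * ((n : ℕ) : ℝ) ^ (-σ) := by
      refine mul_le_mul (hC n) h2 (norm_nonneg _) ?_
      positivity
    _ = C * ‖cmul v₀ n‖ := by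
      rw [h1, mul_assoc, ← Real.rpow_add hnpos]
      congr 2; ring

theorem IsModerate.summable {S : Finset ℕ} (hS : ∀ p ∈ S, p.Prime) {a : ℕ+ → ℂ}
    (ha : IsModerate S a) {σ : ℝ} (hσ : 0 < σ) {v : ℕ → ℂ}
    (hv : ∀ p ∈ S, ‖v p‖ ≤ (p : ℝ) ^ (-σ)) : Summable fun n : ℕ+ => a n * cmul v n := by
  obtain ⟨u, hu, h⟩ := ha.exists_summable_bound hS hσ
  exact Summable.of_norm_bounded hu (h v hv)

theorem IsModerate.continuous_tsum_torusPoint {S : Finset ℕ} (hS : ∀ p ∈ S, p.Prime)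
    {a : ℕ+ → ℂ} (ha : IsModerate S a) {σ : ℝ} (hσ : 0 < σ) :
    Continuous fun χ => ∑' n : ℕ+, a n * cmul (torusPoint σ χ) n := by
  obtain ⟨u, hu, h⟩ := ha.exists_summable_bound hS hσ
  exact continuous_tsum (fun n => continuous_const.mul
    (continuous_cmul_comp (continuous_torusPoint σ) n)) hu fun n χ =>
      h _ (fun p hp => (norm_torusPoint σ χ (hS p hp)).le) n

theorem isOpen_halfPlane (θ : ℝ) : IsOpen (halfPlane θ) :=
  isOpen_lt continuous_const Complex.continuous_re

theorem convex_halfPlane (θ : ℝ) : Convex ℝ (halfPlane θ) := convex_halfSpace_re_gt θ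

theorem IsModerate.differentiableOn_tsum {S : Finset ℕ} (hS : ∀ p ∈ S, p.Prime)
    {a : ℕ+ → ℂ} (ha : IsModerate S a) :
    DifferentiableOn ℂ (fun s => ∑' n : ℕ+, a n * ((n : ℕ) : ℂ) ^ (-s)) (halfPlane 0) := by
  intro s hs
  change 0 < s.re at hs
  obtain ⟨u, hu, h⟩ := ha.exists_summable_bound hS (half_pos hs)
  have hd := Complex.differentiableOn_tsum_of_summable_norm (U := halfPlane (s.re / 2))
    (F := fun (n : ℕ+) (s : ℂ) => a n * ((n : ℕ) : ℂ) ^ (-s)) hu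
    (fun n => by
      have : ((n : ℕ) : ℂ) ≠ 0 := by exact_mod_cast n.ne_zero
      intro w _
      exact ((differentiableAt_const _).mul ((differentiableAt_id.neg).const_cpow
        (Or.inl this))).differentiableWithinAt)
    (isOpen_halfPlane _) (fun n w hw => by
      change s.re / 2 < w.re at hw
      rw [← cmul_cpow n.ne_zero]
      refine h _ (fun p hp => ?_) n
      rw [Complex.norm_natCast_cpow_of_pos (hS p hp).pos, Complex.neg_re]
      exact Real.rpow_le_rpow_of_exponent_le (by exact_mod_cast (hS p hp).one_lt.le)
        (by linarith))
  exact (hd.differentiableAt ((isOpen_halfPlane _).mem_nhds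
    (show s.re / 2 < s.re by linarith))).differentiableWithinAt

/-! ### Uniqueness of coefficients and extension to the polydisc. -/

theorem tsum_pnat_eq_LSeries (b : ℕ+ → ℂ) (s : ℂ) :
    LSeries (fun n => if h : 0 < n then b ⟨n, h⟩ else 0) s =
      ∑' n : ℕ+, b n * ((n : ℕ) : ℂ) ^ (-s) := by
  rw [LSeries, ← Function.Injective.tsum_eq (g := fun n : ℕ+ => (n : ℕ)) PNat.coe_injective]
  · refine tsum_congr fun n => ?_
    rw [LSeries.term_of_ne_zero n.ne_zero, dif_pos n.pos, Complex.cpow_neg, div_eq_mul_inv]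
    rfl
  · intro n hn
    refine ⟨⟨n, Nat.pos_of_ne_zero fun h => hn ?_⟩, rfl⟩
    rw [h, LSeries.term_zero]

/-- Uniqueness of the coefficients of a Dirichlet series. -/
theorem coeff_eq_zero_of_tsum_eq_zero {b : ℕ+ → ℂ} {C : ℝ} (hb : ∀ n, ‖b n‖ ≤ C)
    (h : ∀ σ : ℝ, 1 < σ → ∑' n : ℕ+, b n * ((n : ℕ) : ℂ) ^ (-(σ : ℂ)) = 0) (n : ℕ+) :
    b n = 0 := by
  set f : ℕ → ℂ := fun n => if h : 0 < n then b ⟨n, h⟩ else 0 with hf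
  have h1 : (fun x : ℝ => LSeries f x) =ᶠ[atTop] 0 := by
    filter_upwards [eventually_gt_atTop 1] with σ hσ
    rw [hf, tsum_pnat_eq_LSeries, h σ hσ]; rfl
  have hC : ∃ C, ∀ n ≠ 0, ‖f n‖ ≤ C := by
    refine ⟨C, fun m hm => ?_⟩
    rw [hf]; simp only [Nat.pos_of_ne_zero hm, dite_true]
    exact hb _
  rcases LSeries_eventually_eq_zero_iff'.1 h1 with h2 | h2
  · have := h2 n n.ne_zero
    rw [hf] at this
    simp only [n.pos, dite_true] at this
    exact this
  · have := LSeries.abscissaOfAbsConv_le_of_le_const hC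
    rw [h2] at this
    exact absurd this (by
      rw [not_le]; exact EReal.coe_lt_top 1)

theorem summable_pnat_rpow {σ : ℝ} (hσ : 1 < σ) : Summable fun n : ℕ+ => ((n : ℕ) : ℝ) ^ (-σ) :=
  (Real.summable_nat_rpow.2 (by linarith)).comp_injective PNat.coe_injective

/-- If a Dirichlet series agrees on `Re s > 1` with a function of `p^{-s}`, `p ∈ S`, then it only
involves the primes of `S`, and the corresponding power series is that function. -/
theorem bohr_extension {S : Finset ℕ} (hS : ∀ p ∈ S, p.Prime) {a : ℕ+ → ℂ} {C : ℝ}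
    (ha : ∀ n, ‖a n‖ ≤ C) {H : (ℕ → ℂ) → ℂ}
    (hHS : ∀ v w : ℕ → ℂ, (∀ p ∈ S, v p = w p) → H v = H w)
    (hHd : DifferentiableOn ℂ (fun s : ℂ => H fun p => (p : ℂ) ^ (-s)) (halfPlane 0))
    (hHc : ∀ σ : ℝ, 0 < σ → Continuous fun χ => H (torusPoint σ χ))
    (hH : ∀ s : ℂ, 1 < s.re → ∑' n : ℕ+, a n * ((n : ℕ) : ℂ) ^ (-s) = H fun p => (p : ℂ) ^ (-s)) :
    (∀ n : ℕ+, a n ≠ 0 → IsFactored S n) ∧ ∀ σ : ℝ, 0 < σ → ∀ χ : Nat.Primes → Circle,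
      ∑' n : ℕ+, a n * cmul (torusPoint σ χ) n = H (torusPoint σ χ) := by
  have hflow : ∀ σ t : ℝ, H (torusPoint σ (primeFlow t)) =
      H fun p => (p : ℂ) ^ (-(σ + t * Complex.I)) := fun σ t =>
    hHS _ _ fun p hp => torusPoint_primeFlow σ t (hS p hp)
  have h1 : ∀ σ : ℝ, 1 < σ → ∀ χ : Nat.Primes → Circle,
      ∑' n : ℕ+, a n * cmul (torusPoint σ χ) n = H (torusPoint σ χ) := by
    intro σ hσ
    refine congrFun (denseRange_primeFlow.equalizer ?_ (hHc σ (by linarith)) ?_)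
    · refine continuous_tsum (fun n => continuous_const.mul
        (continuous_cmul_comp (continuous_torusPoint σ) n))
        ((summable_pnat_rpow hσ).mul_left C) fun n χ => ?_
      rw [norm_mul, norm_cmul_torusPoint σ χ n.ne_zero]
      exact mul_le_mul_of_nonneg_right (ha n) (by positivity)
    · funext t
      simp only [Function.comp]
      rw [hflow, ← hH _ (by simpa using hσ)]
      exact tsum_congr fun n => by rw [cmul_torusPoint_primeFlow σ t n.ne_zero]
  have hfac : ∀ n : ℕ+, a n ≠ 0 → IsFactored S n := by
    intro m hm q hq hqm
    by_contra hqS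
    set k := (m : ℕ).factorization q with hk
    have hk0 : k ≠ 0 := (hq.factorization_pos_of_dvd m.ne_zero hqm).ne'
    -- A twist at the single prime `q`, chosen so that the resulting character takes the value -1 at
    -- `m`.
    let χ : Nat.Primes → Circle := fun p => if (p : ℕ) = q then Circle.exp (Real.pi / k) else 1
    have hχm : cmul (primeExt χ) m = -1 := by
      rw [cmul_apply m.ne_zero, Finsupp.prod, Finset.prod_eq_single q]
      · rw [primeExt_of_prime χ hq, ← hk]
        simp only [χ, if_true]
        rw [Circle.coe_exp, ← Complex.exp_nat_mul]
        have : (k : ℂ) ≠ 0 := by exact_mod_cast hk0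
        rw [← Complex.exp_pi_mul_I]
        congr 1
        push_cast
        field_simp
      · intro p hp hpq
        rw [Nat.support_factorization, Nat.mem_primeFactors] at hp
        rw [primeExt_of_prime χ hp.1]
        simp [χ, hpq]
      · intro h
        rw [Nat.support_factorization, Nat.mem_primeFactors] at h
        exact absurd ⟨hq, hqm, m.ne_zero⟩ h
    have hC0 : 0 ≤ C := (norm_nonneg _).trans (ha 1)
    -- `H` does not see the prime `q`, so the twisted and untwisted series have the same sum, and
    -- uniqueness of coefficients applies to their difference.
    have hb := coeff_eq_zero_of_tsum_eq_zero
      (b := fun n : ℕ+ => a n * (cmul (primeExt χ) n - cmul (primeExt fun _ => 1) n)) (C := C * 2)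
      (fun n => by
        rw [norm_mul]
        refine mul_le_mul (ha n) ?_ (norm_nonneg _) hC0
        refine (norm_sub_le _ _).trans ?_
        rw [norm_cmul_eq_one n.ne_zero fun p hp _ => norm_primeExt χ hp,
          norm_cmul_eq_one n.ne_zero fun p hp _ => norm_primeExt (fun _ => 1) hp]
        norm_num)
      (fun σ hσ => by
        have hsum : ∀ χ' : Nat.Primes → Circle,
            Summable fun n : ℕ+ => a n * cmul (torusPoint σ χ') n := fun χ' =>
          Summable.of_norm_bounded ((summable_pnat_rpow hσ).mul_left C) fun n => by
            rw [norm_mul, norm_cmul_torusPoint σ χ' n.ne_zero]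
            exact mul_le_mul_of_nonneg_right (ha n) (by positivity)
        have hdiff := (hsum χ).tsum_sub (hsum fun _ => 1)
        rw [h1 σ hσ, h1 σ hσ, hHS (torusPoint σ χ) (torusPoint σ fun _ => 1), sub_self] at hdiff
        · rw [← hdiff]
          refine tsum_congr fun n => ?_
          have : ∀ χ' : Nat.Primes → Circle, cmul (torusPoint σ χ') n =
              ((n : ℕ) : ℂ) ^ (-(σ : ℂ)) * cmul (primeExt χ') n := fun χ' => by
            rw [← cmul_cpow n.ne_zero, ← cmul_mul_apply]; rfl
          rw [this, this]; ring
        · intro p hp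
          rw [torusPoint, torusPoint, primeExt_of_prime _ (hS p hp),
            primeExt_of_prime _ (hS p hp)]
          have : p ≠ q := fun h => hqS (h ▸ hp)
          simp [χ, this]) m
    have h1m : cmul (primeExt fun _ => 1) m = 1 := by
      rw [cmul_congr (w := fun _ => 1) fun p hp _ => by rw [primeExt_of_prime _ hp]; simp,
        cmul_const_one m.ne_zero]
    rw [hχm, h1m] at hb
    have : (-1 - 1 : ℂ) ≠ 0 := by norm_num
    exact hm ((mul_eq_zero.1 hb).resolve_right this)
  refine ⟨hfac, fun σ hσ => ?_⟩
  have hC0 : 0 ≤ C := (norm_nonneg _).trans (ha 1)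
  have hmod : IsModerate S a := ⟨hfac, fun τ hτ => ⟨C, fun n => (ha n).trans
    (le_mul_of_one_le_right hC0 (Real.one_le_rpow (by exact_mod_cast n.pos) hτ.le))⟩⟩
  -- With finitely many primes the series converges on all of Re s > 0, so the identity theorem
  -- propagates the equality from Re s > 1.
  have hcont : Set.EqOn (fun s : ℂ => ∑' n : ℕ+, a n * ((n : ℕ) : ℂ) ^ (-s))
      (fun s : ℂ => H fun p => (p : ℂ) ^ (-s)) (halfPlane 0) := by
    refine ((hmod.differentiableOn_tsum hS).analyticOnNhd
      (isOpen_halfPlane 0)).eqOn_of_preconnected_of_eventuallyEq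
      (hHd.analyticOnNhd (isOpen_halfPlane 0)) (convex_halfPlane 0).isPreconnected
      (z₀ := 2) (by simp [halfPlane]) ?_
    filter_upwards [(isOpen_halfPlane 1).mem_nhds (show (2 : ℂ) ∈ halfPlane 1 by
      simp [halfPlane])] with s hs using hH s hs
  refine congrFun (denseRange_primeFlow.equalizer (hmod.continuous_tsum_torusPoint hS hσ)
    (hHc σ hσ) ?_)
  funext t
  simp only [Function.comp]
  rw [hflow]
  refine Eq.trans ?_ (hcont (show 0 < (σ + t * Complex.I : ℂ).re by simpa using hσ))
  exact tsum_congr fun n => by rw [cmul_torusPoint_primeFlow σ t n.ne_zero]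

/-! ### Symbols and their Bohr lifts. -/

theorem prime_primeAt (l : ℕ) : (primeAt l).Prime := Nat.prime_nth_prime l

theorem primeAt_injective : Function.Injective primeAt := Nat.nth_injective Nat.infinite_setOfPred_prime

/-- The set of the first `D` primes. -/
def firstPrimes (D : ℕ) : Finset ℕ := (Finset.range D).image primeAt

theorem prime_of_mem_firstPrimes {D p : ℕ} (hp : p ∈ firstPrimes D) : p.Prime := by
  obtain ⟨l, _, rfl⟩ := Finset.mem_image.1 hp
  exact prime_primeAt l

theorem primeAt_mem_firstPrimes {D l : ℕ} (h : l < D) : primeAt l ∈ firstPrimes D :=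
  Finset.mem_image_of_mem _ (Finset.mem_range.2 h)

theorem firstPrimes_mono {D E : ℕ} (h : D ≤ E) : firstPrimes D ⊆ firstPrimes E :=
  Finset.image_subset_image (Finset.range_subset_range.2 h)

namespace GordonHedenmalm

variable (φ : GordonHedenmalm)

theorem tendsto_partialSum {s : ℂ} (hs : 0 < s.re) :
    Tendsto (fun N : ℕ+ => ∑ n ∈ Finset.Icc 1 N, φ.coeff n * ((n : ℕ) : ℂ) ^ (-s)) atTop
      (𝓝 (φ.psi s)) :=
  (φ.tendstoUniformlyOn (s.re / 2) (half_pos hs)).tendsto_at (show s.re / 2 < s.re by linarith)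

theorem exists_norm_coeff_le {σ : ℝ} (hσ : 0 < σ) :
    ∃ C : ℝ, ∀ n : ℕ+, ‖φ.coeff n‖ ≤ C * (n : ℝ) ^ σ := by
  have ht := φ.tendsto_partialSum (s := σ) (by simpa using hσ)
  obtain ⟨N₀, hN₀⟩ := (Metric.tendsto_atTop.1 ht) 1 one_pos
  set b : ℕ+ → ℂ := fun n => φ.coeff n * ((n : ℕ) : ℂ) ^ (-(σ : ℂ)) with hb
  -- Beyond `N₀` two consecutive partial sums lie within 1 of the limit, so a term has modulus at
  -- most 2; the sum accounts for the earlier terms.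
  have hbound : ∀ n, ‖b n‖ ≤ 2 + ∑ m ∈ Finset.Icc 1 N₀, ‖b m‖ := by
    intro n
    have hnn : 0 ≤ ∑ m ∈ Finset.Icc 1 N₀, ‖b m‖ := Finset.sum_nonneg fun _ _ => norm_nonneg _
    rcases le_or_gt n N₀ with h | h
    · have := Finset.single_le_sum (f := fun m => ‖b m‖) (fun _ _ => norm_nonneg _)
        (Finset.mem_Icc.2 ⟨one_le, h⟩)
      linarith
    · obtain ⟨m, rfl⟩ := PNat.exists_eq_succ_of_ne_one (n := n) (by
        rintro rfl; exact absurd h (not_lt.2 (one_le)))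
      have hm : N₀ ≤ m := PNat.lt_add_one_iff.1 h
      have hI : Finset.Icc 1 (m + 1) = insert (m + 1) (Finset.Icc 1 m) := by
        ext k
        simp only [Finset.mem_insert, Finset.mem_Icc, one_le, true_and]
        rw [← PNat.coe_le_coe, ← PNat.coe_inj, ← PNat.coe_le_coe, PNat.add_coe]
        have := k.pos
        simp only [PNat.one_coe]
        omega
      have h1 := hN₀ _ (hm.trans (PNat.lt_add_right m 1).le)
      have h2 := hN₀ _ hm
      rw [hI, Finset.sum_insert (by simp), dist_eq_norm] at h1
      rw [dist_eq_norm] at h2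
      have h3 : b (m + 1) = (b (m + 1) + ∑ n ∈ Finset.Icc 1 m, b n - φ.psi σ) -
          (∑ n ∈ Finset.Icc 1 m, b n - φ.psi σ) := by ring
      rw [h3]
      refine (norm_sub_le _ _).trans ?_
      linarith
  refine ⟨2 + ∑ m ∈ Finset.Icc 1 N₀, ‖b m‖, fun n => ?_⟩
  have hnpos : (0 : ℝ) < (n : ℕ) := by exact_mod_cast n.pos
  have h := hbound n
  simp only [hb] at h
  rw [norm_mul, Complex.norm_natCast_cpow_of_pos n.pos] at h
  simp only [Complex.neg_re, Complex.ofReal_re] at h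
  rw [Real.rpow_neg hnpos.le, ← div_eq_mul_inv, div_le_iff₀ (by positivity)] at h
  simpa only [hb] using h

variable {φ} {d : ℕ}

theorem isModerate_coeff (hd : φ.InvolvesOnlyFirst d) : IsModerate (firstPrimes d) φ.coeff where
  factored n hn p hp hpn := by
    obtain ⟨l, rfl⟩ := hd n hn p hp hpn
    exact primeAt_mem_firstPrimes l.2
  growth _ hσ := φ.exists_norm_coeff_le hσ

theorem psi_eq_tsum (hd : φ.InvolvesOnlyFirst d) {s : ℂ} (hs : 0 < s.re) :
    φ.psi s = ∑' n : ℕ+, φ.coeff n * ((n : ℕ) : ℂ) ^ (-s) := by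
  have hsum : Summable fun n : ℕ+ => φ.coeff n * ((n : ℕ) : ℂ) ^ (-s) := by
    have := (isModerate_coeff hd).summable (fun p => prime_of_mem_firstPrimes) hs
      (v := fun p => (p : ℂ) ^ (-s)) (fun p hp => by
        rw [Complex.norm_natCast_cpow_of_pos (prime_of_mem_firstPrimes hp).pos, Complex.neg_re])
    refine this.congr fun n => ?_
    rw [cmul_cpow n.ne_zero]
  have hI : Tendsto (fun N : ℕ+ => Finset.Icc 1 N) atTop atTop :=
    tendsto_atTop_finset_of_monotone (fun a b h => Finset.Icc_subset_Icc_right h)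
      fun n => ⟨n, Finset.mem_Icc.2 ⟨one_le, le_rfl⟩⟩
  exact tendsto_nhds_unique (φ.tendsto_partialSum hs) (hsum.hasSum.comp hI)

theorem differentiableOn_psi (hd : φ.InvolvesOnlyFirst d) :
    DifferentiableOn ℂ φ.psi (halfPlane 0) :=
  ((isModerate_coeff hd).differentiableOn_tsum fun _ => prime_of_mem_firstPrimes).congr
    fun _ hs => psi_eq_tsum hd hs

theorem bohrLift_eq_tsum (hd : φ.InvolvesOnlyFirst d) (v : ℕ → ℂ) :
    φ.bohrLift d (fun l => v (primeAt l)) = ∑' n : ℕ+, φ.coeff n * cmul v n := by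
  refine tsum_congr fun n => ?_
  by_cases hn : φ.coeff n = 0
  · rw [hn, zero_mul, zero_mul]
  rw [cmul_apply n.ne_zero, Finsupp.prod_of_support_subset (s := firstPrimes d)]
  · rw [firstPrimes, Finset.prod_image fun _ _ _ _ h => primeAt_injective h, Finset.prod_range]
  · intro p hp
    rw [Nat.support_factorization, Nat.mem_primeFactors] at hp
    exact (isModerate_coeff hd).factored n hn p hp.1 hp.2.1
  · simp

variable {F : (Fin d → ℂ) → ℂ}

theorem lift_eq_tsum (hd : φ.InvolvesOnlyFirst d) (hF : φ.IsC2BohrLift d F) {v : ℕ → ℂ}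
    (hv : ∀ p ∈ firstPrimes d, ‖v p‖ < 1) :
    F (fun l => v (primeAt l)) = ∑' n : ℕ+, φ.coeff n * cmul v n := by
  rw [← bohrLift_eq_tsum hd]
  exact hF.2 fun l => hv _ (primeAt_mem_firstPrimes l.2)

theorem lift_cpow (hd : φ.InvolvesOnlyFirst d) (hF : φ.IsC2BohrLift d F) {s : ℂ}
    (hs : 0 < s.re) : F (fun l => (primeAt l : ℂ) ^ (-s)) = φ.psi s := by
  rw [lift_eq_tsum hd hF (v := fun p => (p : ℂ) ^ (-s)), psi_eq_tsum hd hs]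
  · exact tsum_congr fun n => by rw [cmul_cpow n.ne_zero]
  · exact fun p hp => norm_cpow_neg_lt_one (prime_of_mem_firstPrimes hp) hs

theorem _root_.norm_torusPoint_lt_one {σ : ℝ} (hσ : 0 < σ) (χ : Nat.Primes → Circle) {p : ℕ}
    (hp : p.Prime) : ‖torusPoint σ χ p‖ < 1 := by
  rw [norm_torusPoint σ χ hp]
  exact Real.rpow_lt_one_of_one_lt_of_neg (by exact_mod_cast hp.one_lt) (by linarith)

theorem lift_torusPoint (hd : φ.InvolvesOnlyFirst d) (hF : φ.IsC2BohrLift d F) {σ : ℝ}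
    (hσ : 0 < σ) (χ : Nat.Primes → Circle) :
    F (fun l => torusPoint σ χ (primeAt l)) = ∑' n : ℕ+, φ.coeff n * cmul (torusPoint σ χ) n :=
  lift_eq_tsum hd hF fun _ hp => norm_torusPoint_lt_one hσ χ (prime_of_mem_firstPrimes hp)

theorem continuous_lift_torusPoint (hd : φ.InvolvesOnlyFirst d) (hF : φ.IsC2BohrLift d F)
    {σ : ℝ} (hσ : 0 < σ) : Continuous fun χ => F (fun l => torusPoint σ χ (primeAt l)) := by
  simp only [lift_torusPoint hd hF hσ]
  exact (isModerate_coeff hd).continuous_tsum_torusPoint (fun _ => prime_of_mem_firstPrimes) hσ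

theorem re_psi_nonneg {s : ℂ} (hs : 0 < s.re) : 0 ≤ (φ.psi s).re := by
  rcases Nat.eq_zero_or_pos φ.char with h | h
  · have h1 : 1 / 2 < (φ.psi s).re := φ.mapsTo_of_char_eq_zero h s hs
    linarith
  · rcases φ.mapsTo_of_one_le_char h with ⟨h1, h2⟩ | h1
    · rwa [h1 s hs]
    · exact le_of_lt (h1 s hs)

/-- On the flow the lift takes the values of ψ on the line Re s = σ, where the bound is known;
density and continuity extend it to the torus. -/
theorem le_re_lift_torusPoint (hd : φ.InvolvesOnlyFirst d) (hF : φ.IsC2BohrLift d F) {σ κ : ℝ}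
    (hσ : 0 < σ) (hκ : ∀ s : ℂ, 0 < s.re → κ ≤ (φ.psi s).re) (χ : Nat.Primes → Circle) :
    κ ≤ (F (fun l => torusPoint σ χ (primeAt l))).re := by
  have hclosed : IsClosed {χ : Nat.Primes → Circle |
      κ ≤ (F (fun l => torusPoint σ χ (primeAt l))).re} :=
    isClosed_le continuous_const
      (Complex.continuous_re.comp (continuous_lift_torusPoint hd hF hσ))
  refine denseRange_primeFlow.induction_on (p := fun χ =>
    κ ≤ (F (fun l => torusPoint σ χ (primeAt l))).re) χ hclosed fun t => ?_
  have hs : 0 < (σ + t * Complex.I : ℂ).re := by simpa using hσ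
  have h1 : (fun l : Fin d => torusPoint σ (primeFlow t) (primeAt l)) =
      fun l : Fin d => (primeAt l : ℂ) ^ (-(σ + t * Complex.I)) :=
    funext fun l => torusPoint_primeFlow σ t (prime_primeAt l)
  rw [h1, lift_cpow hd hF hs]
  exact hκ _ hs

end GordonHedenmalm

theorem exists_pos_forall_le_rpow_neg (S : Finset ℕ) (hS : ∀ p ∈ S, p.Prime) {r : ℝ} (hr : r < 1) :
    ∃ σ : ℝ, 0 < σ ∧ ∀ p ∈ S, r ≤ (p : ℝ) ^ (-σ) := by
  have h : ∀ᶠ σ : ℝ in 𝓝[>] 0, ∀ p ∈ S, r ≤ (p : ℝ) ^ (-σ) := by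
    rw [eventually_all_finset]
    intro p hp
    have hc : ContinuousAt (fun σ : ℝ => (p : ℝ) ^ (-σ)) 0 := by
      have : (p : ℝ) ≠ 0 := by exact_mod_cast (hS p hp).ne_zero
      exact (Real.continuousAt_const_rpow this).comp (f := fun σ : ℝ => -σ) (by fun_prop)
    have := hc.tendsto
    simp only [neg_zero, Real.rpow_zero] at this
    filter_upwards [(this.mono_left nhdsWithin_le_nhds).eventually (lt_mem_nhds hr)] with σ hσ
      using hσ.le
  obtain ⟨σ, hσ, h0⟩ := (h.and self_mem_nhdsWithin).exists
  exact ⟨σ, h0, hσ⟩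

theorem exists_primeAt_extension {d : ℕ} {α : Type*} (z : Fin d → α) (a : α) :
    ∃ v : ℕ → α, (∀ l : Fin d, v (primeAt l) = z l) ∧ ∀ l, d ≤ l → v (primeAt l) = a := by
  have hinj : Function.Injective fun l : Fin d => primeAt l :=
    fun _ _ h => Fin.val_injective (primeAt_injective h)
  refine ⟨Function.extend (fun l : Fin d => primeAt l) z fun _ => a, fun l => ?_, fun l hl => ?_⟩
  · exact hinj.extend_apply z _ l
  · refine Function.extend_apply' _ _ _ ?_
    rintro ⟨k, hk⟩
    have := primeAt_injective hk
    omega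

/-- The lift is holomorphic along complex lines in the polydisc. -/
theorem GordonHedenmalm.differentiableAt_lift_line {φ : GordonHedenmalm} {d : ℕ}
    {F : (Fin d → ℂ) → ℂ} (hd : φ.InvolvesOnlyFirst d) (hF : φ.IsC2BohrLift d F)
    {z : Fin d → ℂ} (hz : z ∈ openPolydisc d) (e : Fin d → ℂ) :
    DifferentiableAt ℂ (fun ζ : ℂ => F (z + ζ • e)) 0 := by
  obtain ⟨v, hv, -⟩ := exists_primeAt_extension z 0
  obtain ⟨f, hf, -⟩ := exists_primeAt_extension e 0
  obtain ⟨r, hr, hzr⟩ : ∃ r < 1, ∀ l, ‖z l‖ < r := by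
    have h : ∀ᶠ r in 𝓝[<] (1 : ℝ), ∀ l, ‖z l‖ < r := by
      rw [eventually_all]
      exact fun l => nhdsWithin_le_nhds (lt_mem_nhds (hz l))
    obtain ⟨r, h, hr⟩ := (h.and self_mem_nhdsWithin).exists
    exact ⟨r, hr, h⟩
  obtain ⟨σ, hσ, hrσ⟩ := exists_pos_forall_le_rpow_neg (firstPrimes d)
    (fun _ => prime_of_mem_firstPrimes) hr
  obtain ⟨u, hu, hub⟩ := (isModerate_coeff hd).exists_summable_bound
    (fun _ => prime_of_mem_firstPrimes) hσ
  -- On `U` each coordinate is smaller than r ≤ p^{-σ}, the range in which the series has a uniform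
  -- summable majorant.
  set U : Set ℂ := {ζ | ∀ l, ‖z l + ζ * e l‖ < r} with hU
  have hUo : IsOpen U := by
    rw [hU, Set.ofPred_forall]
    exact isOpen_iInter_of_finite fun l => isOpen_lt (by fun_prop) continuous_const
  have h0U : (0 : ℂ) ∈ U := fun l => by simpa using hzr l
  have hle : ∀ ζ ∈ U, ∀ p ∈ firstPrimes d, ‖v p + ζ * f p‖ < r := by
    intro ζ hζ p hp
    obtain ⟨l, hl, rfl⟩ := Finset.mem_image.1 hp
    have := hζ ⟨l, Finset.mem_range.1 hl⟩
    rwa [← hv, ← hf] at this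
  have hdiff := Complex.differentiableOn_tsum_of_summable_norm (U := U)
    (F := fun (n : ℕ+) (ζ : ℂ) => φ.coeff n * cmul (fun p => v p + ζ * f p) n) hu
    (fun n => by
      simp only [cmul_apply n.ne_zero, Finsupp.prod]
      fun_prop) hUo
    (fun n ζ hζ => hub _ (fun p hp => ((hle ζ hζ p hp).le.trans (hrσ p hp))) n)
  refine ((hdiff.congr fun ζ hζ => ?_).differentiableAt (hUo.mem_nhds h0U))
  rw [← lift_eq_tsum hd hF fun p hp => (hle ζ hζ p hp).trans hr]
  congr 1
  funext l
  simp [hv, hf]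

/-! ### Kernels and the action of the operator on them. -/

theorem memlp_two_of_summable {a : ℕ+ → ℂ} (h : Summable fun n => ‖a n‖ ^ 2) :
    Memℓp a 2 := by
  rw [memℓp_gen_iff (by norm_num)]
  simpa using h

/-- The sequence `(cmul v n)ₙ` as an element of the space, and its norm. -/
theorem exists_kernel {S : Finset ℕ} (hS : ∀ p ∈ S, p.Prime) {v : ℕ → ℂ}
    (hv : ∀ p ∈ S, ‖v p‖ < 1) (hv0 : ∀ p ∉ S, v p = 0) :
    ∃ k : HardyDirichlet, (∀ n : ℕ+, k n = cmul v n) ∧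
      ‖k‖ ^ 2 = ∏ p ∈ S, (1 - ‖v p‖ ^ 2)⁻¹ := by
  obtain ⟨h1, h2⟩ := hasSum_cmul (v := fun p => ((‖v p‖ ^ 2 : ℝ) : ℂ)) hS
    (fun p hp => by
      rw [Complex.norm_real, Real.norm_of_nonneg (by positivity)]
      exact pow_lt_one₀ (norm_nonneg _) (hv p hp) two_ne_zero)
    (fun p hp => by simp [hv0 p hp])
  have h3 : ∀ n : ℕ, cmul (fun p => ((‖v p‖ ^ 2 : ℝ) : ℂ)) n = ((‖cmul v n‖ ^ 2 : ℝ) : ℂ) := by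
    intro n
    have : (fun p => ((‖v p‖ ^ 2 : ℝ) : ℂ)) = fun p => (‖v p‖ : ℂ) * (‖v p‖ : ℂ) := by
      funext p; push_cast; ring
    rw [this, cmul_mul_apply, norm_cmul]; push_cast; ring
  simp only [h3] at h1 h2
  have h4 : Summable fun n : ℕ+ => ‖cmul v n‖ ^ 2 := by
    refine h1.congr fun n => ?_
    rw [Complex.norm_real, Real.norm_of_nonneg (by positivity)]
  refine ⟨⟨fun n => cmul v n, memlp_two_of_summable h4⟩, fun n => rfl, ?_⟩
  have h5 := lp.norm_rpow_eq_tsum (p := 2) (by norm_num)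
    (⟨fun n => cmul v n, memlp_two_of_summable h4⟩ : HardyDirichlet)
  simp only [ENNReal.toReal_ofNat, Real.rpow_ofNat] at h5
  rw [h5]
  have h6 : HasSum (fun n : ℕ+ => ‖cmul v n‖ ^ 2) (∏ p ∈ S, (1 - ‖v p‖ ^ 2)⁻¹) := by
    rw [← Complex.hasSum_ofReal]
    convert h2 using 1
    push_cast
    rfl
  exact h6.tsum_eq

theorem kernel_toFun {S : Finset ℕ} (hS : ∀ p ∈ S, p.Prime) {v : ℕ → ℂ}
    (hv : ∀ p ∈ S, ‖v p‖ < 1) (hv0 : ∀ p ∉ S, v p = 0) {k : HardyDirichlet}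
    (hk : ∀ n : ℕ+, k n = cmul v n) {s : ℂ} (hs : 0 < s.re) :
    k.toFun s = ∏ p ∈ S, (1 - v p * (p : ℂ) ^ (-s))⁻¹ := by
  have h := (hasSum_cmul (v := fun p => v p * (p : ℂ) ^ (-s)) hS
    (fun p hp => by
      rw [norm_mul]
      exact mul_lt_one_of_nonneg_of_lt_one_left (norm_nonneg _) (hv p hp)
        (norm_cpow_neg_lt_one (hS p hp) hs).le)
    (fun p hp => by simp [hv0 p hp])).2
  rw [← h.tsum_eq, HardyDirichlet.toFun]
  exact tsum_congr fun n => by rw [hk, cmul_mul_apply, cmul_cpow n.ne_zero]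

/-- The kernel with parameter `v`, composed with the lift of the symbol `c s + ψ`. -/
def liftedKernel {d : ℕ} (S : Finset ℕ) (v : ℕ → ℂ) (c : ℕ) (F : (Fin d → ℂ) → ℂ)
    (w : ℕ → ℂ) : ℂ :=
  ∏ p ∈ S, (1 - v p * (w p ^ c * (p : ℂ) ^ (-F fun l => w (primeAt l))))⁻¹

theorem norm_pow_mul_cpow_le_one {p : ℕ} (hp : p.Prime) {x : ℂ} (hx : ‖x‖ ≤ 1) (c : ℕ) {y : ℂ}
    (hy : 0 ≤ y.re) : ‖x ^ c * (p : ℂ) ^ (-y)‖ ≤ 1 := by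
  rw [norm_mul, norm_pow, Complex.norm_natCast_cpow_of_pos hp.pos, Complex.neg_re]
  refine mul_le_one₀ (pow_le_one₀ (norm_nonneg _) hx) (by positivity) ?_
  exact Real.rpow_le_one_of_one_le_of_nonpos (by exact_mod_cast hp.one_lt.le) (by linarith)

theorem one_sub_mul_ne_zero {x y : ℂ} (hx : ‖x‖ < 1) (hy : ‖y‖ ≤ 1) : 1 - x * y ≠ 0 := by
  intro h
  have h1 : ‖x * y‖ = 1 := by rw [← sub_eq_zero.1 h, norm_one]
  rw [norm_mul] at h1
  have := mul_lt_one_of_nonneg_of_lt_one_left (norm_nonneg _) hx hy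
  linarith

open GordonHedenmalm in
/-- A linear combination of composition operators, applied to a kernel, extends to a function on
the polydisc. -/
theorem tsum_apply_kernel_eq {d N : ℕ} {φ : Fin N → GordonHedenmalm}
    (hd : ∀ j, (φ j).InvolvesOnlyFirst d) {F : Fin N → (Fin d → ℂ) → ℂ}
    (hF : ∀ j, (φ j).IsC2BohrLift d (F j)) {lam : Fin N → ℂ}
    {T : HardyDirichlet →L[ℂ] HardyDirichlet}
    (hT : ∀ f : HardyDirichlet, ∀ s ∈ halfPlane (1 / 2),
      (T f).toFun s = ∑ j, lam j * (φ j).comp f s)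
    {S : Finset ℕ} (hS : ∀ p ∈ S, p.Prime) (hdS : firstPrimes d ⊆ S) {v : ℕ → ℂ}
    (hv : ∀ p ∈ S, ‖v p‖ < 1) (hv0 : ∀ p ∉ S, v p = 0) {k : HardyDirichlet}
    (hk : ∀ n : ℕ+, k n = cmul v n) :
    (∀ n : ℕ+, T k n ≠ 0 → IsFactored S n) ∧ ∀ σ : ℝ, 0 < σ → ∀ χ : Nat.Primes → Circle,
      ∑' n : ℕ+, T k n * cmul (torusPoint σ χ) n =
        ∑ j, lam j * liftedKernel S v (φ j).char (F j) (torusPoint σ χ) := by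
  refine bohr_extension hS (C := ‖T k‖) (fun n => lp.norm_apply_le_norm two_ne_zero _ n)
    (H := fun w => ∑ j, lam j * liftedKernel S v (φ j).char (F j) w) ?_ ?_ ?_ ?_
  · intro x y hxy
    refine Finset.sum_congr rfl fun j _ => ?_
    congr 1
    refine Finset.prod_congr rfl fun p hp => ?_
    have : (fun l : Fin d => x (primeAt l)) = fun l : Fin d => y (primeAt l) :=
      funext fun l : Fin d => hxy _ (hdS (primeAt_mem_firstPrimes l.2))
    rw [hxy p hp, this]
  · refine DifferentiableOn.fun_sum fun j _ => (differentiableOn_const _).mul ?_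
    refine DifferentiableOn.fun_finsetProd fun p hp => ?_
    have hp0 : (p : ℂ) ≠ 0 := by exact_mod_cast (hS p hp).ne_zero
    refine DifferentiableOn.inv ?_ fun s hs => ?_
    · refine (differentiableOn_const _).sub ((differentiableOn_const _).mul (.mul (.pow ?_ _) ?_))
      · exact fun s _ => ((differentiableAt_id.neg).const_cpow
          (Or.inl hp0)).differentiableWithinAt
      · refine DifferentiableOn.congr (f := fun s => (p : ℂ) ^ (-(φ j).psi s)) ?_ fun s hs => by
          rw [lift_cpow (hd j) (hF j) hs]
        exact fun s hs => (differentiableOn_psi (hd j) s hs).neg.const_cpow (Or.inl hp0)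
    · refine one_sub_mul_ne_zero (hv p hp) (norm_pow_mul_cpow_le_one (hS p hp)
        (norm_cpow_neg_lt_one (hS p hp) hs).le _ ?_)
      rw [lift_cpow (hd j) (hF j) hs]
      exact re_psi_nonneg hs
  · intro σ hσ
    refine continuous_finsetSum _ fun j _ => continuous_const.mul ?_
    refine continuous_finsetProd _ fun p hp => ?_
    have hp0 : (p : ℂ) ≠ 0 := by exact_mod_cast (hS p hp).ne_zero
    refine Continuous.inv₀ ?_ fun χ => ?_
    · exact continuous_const.sub (continuous_const.mul (((continuous_torusPoint σ p).pow _).mul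
        ((continuous_lift_torusPoint (hd j) (hF j) hσ).neg.const_cpow (Or.inl hp0))))
    · exact one_sub_mul_ne_zero (hv p hp) (norm_pow_mul_cpow_le_one (hS p hp)
        (norm_torusPoint_lt_one hσ χ (hS p hp)).le _
        (le_re_lift_torusPoint (hd j) (hF j) hσ (fun s => re_psi_nonneg) χ))
  · intro s hs
    have hs0 : 0 < s.re := by linarith
    have hs2 : s ∈ halfPlane (1 / 2) := by change 1 / 2 < s.re; linarith
    change (T k).toFun s = _
    rw [hT k s hs2]
    refine Finset.sum_congr rfl fun j _ => ?_
    congr 1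
    have hφ : (1 / 2 : ℝ) < ((φ j).toFun s).re := (φ j).mapsTo s hs2
    rw [GordonHedenmalm.comp, kernel_toFun hS hv hv0 hk (by linarith), liftedKernel]
    refine Finset.prod_congr rfl fun p hp => ?_
    have hp0 : (p : ℂ) ≠ 0 := by exact_mod_cast (hS p hp).ne_zero
    rw [lift_cpow (hd j) (hF j) hs0, GordonHedenmalm.toFun, neg_add, Complex.cpow_add _ _ hp0,
      ← mul_neg, Complex.cpow_nat_mul]

/-! ### Complex differentiability up to the boundary of the polydisc. -/

section Polydisc

variable {d : ℕ}

theorem convex_closedPolydisc : Convex ℝ (closedPolydisc d) := by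
  intro x hx y hy a b ha hb hab l
  calc ‖(a • x + b • y) l‖ ≤ ‖a • x l‖ + ‖b • y l‖ := norm_add_le _ _
    _ = a * ‖x l‖ + b * ‖y l‖ := by
      rw [norm_smul, norm_smul, Real.norm_of_nonneg ha, Real.norm_of_nonneg hb]
    _ ≤ a * 1 + b * 1 := by
      gcongr
      · exact hx l
      · exact hy l
    _ = 1 := by rw [mul_one, mul_one, hab]

theorem isOpen_openPolydisc : IsOpen (openPolydisc d) := by
  rw [openPolydisc, Set.ofPred_forall]
  exact isOpen_iInter_of_finite fun l => isOpen_lt (by fun_prop) continuous_const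

theorem openPolydisc_subset : openPolydisc d ⊆ closedPolydisc d := fun _ hz l => (hz l).le

theorem openPolydisc_subset_interior : openPolydisc d ⊆ interior (closedPolydisc d) :=
  interior_maximal openPolydisc_subset isOpen_openPolydisc

theorem closedPolydisc_subset_closure : closedPolydisc d ⊆ closure (openPolydisc d) := by
  intro z hz
  have ht : Tendsto (fun r : ℝ => r • z) (𝓝[<] 1) (𝓝 z) := by
    have : Tendsto (fun r : ℝ => r • z) (𝓝 1) (𝓝 ((1 : ℝ) • z)) :=
      (continuous_id.smul continuous_const).tendsto 1
    rw [one_smul] at this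
    exact this.mono_left nhdsWithin_le_nhds
  refine mem_closure_of_tendsto ht ?_
  filter_upwards [self_mem_nhdsWithin, nhdsWithin_le_nhds (lt_mem_nhds (zero_lt_one' ℝ))]
    with r hr hr0 l
  calc ‖(r • z) l‖ = r * ‖z l‖ := by rw [Pi.smul_apply, norm_smul, Real.norm_of_nonneg hr0.le]
    _ ≤ r * 1 := by gcongr; exact hz l
    _ < 1 := by simpa using hr

theorem uniqueDiffOn_closedPolydisc : UniqueDiffOn ℝ (closedPolydisc d) :=
  uniqueDiffOn_convex convex_closedPolydisc
    ⟨0, openPolydisc_subset_interior fun l => by simp⟩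

theorem uniqueDiffWithinAt_closedPolydisc {ξ : Fin d → ℂ} (hξ : ξ ∈ closedPolydisc d) :
    UniqueDiffWithinAt ℂ (closedPolydisc d) ξ :=
  (uniqueDiffOn_closedPolydisc ξ hξ).mono_field

/-- The real derivative of `G` on the closed polydisc is complex linear. -/
def HasComplexLinearDeriv (G : (Fin d → ℂ) → ℂ) : Prop :=
  DifferentiableOn ℝ G (closedPolydisc d) ∧ ∀ ξ ∈ closedPolydisc d, ∀ e,
    fderivWithin ℝ G (closedPolydisc d) ξ (Complex.I • e) =
      Complex.I * fderivWithin ℝ G (closedPolydisc d) ξ e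

/-- A real linear map commuting with multiplication by `i`, as a complex linear map. -/
def complexLinearOfI {E : Type*} [NormedAddCommGroup E] [NormedSpace ℂ E] (L : E →L[ℝ] ℂ)
    (h : ∀ e, L (Complex.I • e) = Complex.I * L e) : E →L[ℂ] ℂ where
  toFun := L
  map_add' := L.map_add
  map_smul' c x := by
    have hc : c • x = c.re • x + c.im • (Complex.I • x) := by
      conv_lhs => rw [← Complex.re_add_im c]
      rw [add_smul, mul_smul]
      rfl
    rw [hc, L.map_add, L.map_smul, L.map_smul, h]
    simp only [Complex.real_smul, smul_eq_mul, RingHom.id_apply]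
    conv_rhs => rw [← Complex.re_add_im c]
    ring
  cont := L.continuous

theorem HasComplexLinearDeriv.hasFDerivWithinAt {G : (Fin d → ℂ) → ℂ}
    (hG : HasComplexLinearDeriv G) {ξ : Fin d → ℂ} (hξ : ξ ∈ closedPolydisc d) :
    HasFDerivWithinAt G (complexLinearOfI _ (hG.2 ξ hξ)) (closedPolydisc d) ξ :=
  HasFDerivWithinAt.of_restrictScalars ℝ (hG.1 ξ hξ).hasFDerivWithinAt rfl

theorem HasComplexLinearDeriv.partialDeriv_eq {G : (Fin d → ℂ) → ℂ}
    (hG : HasComplexLinearDeriv G) {ξ : Fin d → ℂ} (hξ : ξ ∈ closedPolydisc d) (l : Fin d) :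
    partialDeriv l G ξ = fderivWithin ℝ G (closedPolydisc d) ξ (Pi.single l 1) := by
  rw [partialDeriv, (hG.hasFDerivWithinAt hξ).fderivWithin (uniqueDiffWithinAt_closedPolydisc hξ)]
  rfl

/-- The derivative of `G` along a curve in the closed polydisc. -/
theorem HasComplexLinearDeriv.hasDerivAt_comp {G : (Fin d → ℂ) → ℂ}
    (hG : HasComplexLinearDeriv G) {w : ℝ → Fin d → ℂ} (hw : ∀ t, w t ∈ closedPolydisc d)
    {w' : Fin d → ℂ} {t : ℝ} (hd : HasDerivAt w w' t) :
    HasDerivAt (fun t => G (w t)) (∑ l, w' l * partialDeriv l G (w t)) t := by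
  have h := (hG.1 _ (hw t)).hasFDerivWithinAt.comp_hasDerivWithinAt t (s := Set.univ)
    hd.hasDerivWithinAt (fun t _ => hw t)
  rw [hasDerivWithinAt_univ] at h
  refine h.congr_deriv ?_
  have h1 : fderivWithin ℝ G (closedPolydisc d) (w t) w' =
      complexLinearOfI _ (hG.2 _ (hw t)) w' := rfl
  have h2 : w' = ∑ l, w' l • (Pi.single l 1 : Fin d → ℂ) := pi_eq_sum_univ' w'
  rw [h1]
  conv_lhs => rw [h2]
  rw [map_sum]
  refine Finset.sum_congr rfl fun l _ => ?_
  rw [map_smul, smul_eq_mul, hG.partialDeriv_eq (hw t)]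
  rfl

variable {φ : GordonHedenmalm} {F : (Fin d → ℂ) → ℂ}

/-- Inside the polydisc this is holomorphy; the real derivative is continuous up to the boundary, so
the Cauchy–Riemann identity persists there. It guarantees that the complex derivative in
`partialDeriv` exists at boundary points and is not a default value. -/
theorem hasComplexLinearDeriv_lift (hd : φ.InvolvesOnlyFirst d) (hF : φ.IsC2BohrLift d F) :
    HasComplexLinearDeriv F := by
  have hdiff := hF.1.differentiableOn two_ne_zero
  refine ⟨hdiff, fun ξ hξ e => ?_⟩
  have hcont := hF.1.continuousOn_fderivWithin uniqueDiffOn_closedPolydisc (by norm_num)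
  refine Set.EqOn.of_subset_closure (s := openPolydisc d)
    (f := fun ξ => fderivWithin ℝ F (closedPolydisc d) ξ (Complex.I • e))
    (g := fun ξ => Complex.I * fderivWithin ℝ F (closedPolydisc d) ξ e) ?_
    (hcont.clm_apply continuousOn_const) (continuousOn_const.mul (hcont.clm_apply continuousOn_const))
    openPolydisc_subset closedPolydisc_subset_closure hξ
  intro z hz
  have hnhds : closedPolydisc d ∈ 𝓝 z :=
    mem_of_superset (isOpen_openPolydisc.mem_nhds hz) openPolydisc_subset
  have hFz : DifferentiableAt ℝ F z := (hdiff z (openPolydisc_subset hz)).differentiableAt hnhds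
  simp only [fderivWithin_of_mem_nhds hnhds]
  -- The real derivative along the complex line is computed twice, as multiplication by `g'` and by
  -- the chain rule; comparing the values at `I` and at 1 gives the claim.
  have hline := (GordonHedenmalm.differentiableAt_lift_line hd hF hz e).hasDerivAt
  set g' := deriv (fun ζ : ℂ => F (z + ζ • e)) 0
  have h1 : HasFDerivAt (fun ζ : ℂ => F (z + ζ • e))
      ((ContinuousLinearMap.toSpanSingleton ℂ g').restrictScalars ℝ) 0 :=
    hline.hasFDerivAt.restrictScalars ℝ
  have hl : HasFDerivAt (𝕜 := ℝ) (fun ζ : ℂ => z + ζ • e)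
      ((ContinuousLinearMap.toSpanSingleton ℂ e).restrictScalars ℝ) 0 := by
    have : HasFDerivAt (𝕜 := ℂ) (fun ζ : ℂ => z + ζ • e)
        (ContinuousLinearMap.toSpanSingleton ℂ e) 0 :=
      (ContinuousLinearMap.toSpanSingleton ℂ e).hasFDerivAt.const_add z
    exact this.restrictScalars ℝ
  have h2 : HasFDerivAt (fun ζ : ℂ => F (z + ζ • e)) ((fderiv ℝ F z).comp
      ((ContinuousLinearMap.toSpanSingleton ℂ e).restrictScalars ℝ)) 0 := by
    refine HasFDerivAt.comp (g := F) (0 : ℂ) ?_ hl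
    rw [zero_smul, add_zero]
    exact hFz.hasFDerivAt
  have h3 := h1.unique h2
  have hI := congrArg (fun L : ℂ →L[ℝ] ℂ => L Complex.I) h3
  have h1' := congrArg (fun L : ℂ →L[ℝ] ℂ => L 1) h3
  simp at hI h1'
  rw [← hI, ← h1']

theorem differentiableOn_lift_fderivWithin_apply (hF : φ.IsC2BohrLift d F) (e : Fin d → ℂ) :
    DifferentiableOn ℝ (fun ξ => fderivWithin ℝ F (closedPolydisc d) ξ e) (closedPolydisc d) :=
  ((hF.1.fderivWithin (m := 1) uniqueDiffOn_closedPolydisc (by norm_num)).differentiableOn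
    one_ne_zero).clm_apply (differentiableOn_const _)

theorem fderivWithin_fderivWithin_apply (hF : φ.IsC2BohrLift d F) (e e' : Fin d → ℂ)
    {ξ : Fin d → ℂ} (hξ : ξ ∈ closedPolydisc d) :
    fderivWithin ℝ (fun ξ => fderivWithin ℝ F (closedPolydisc d) ξ e) (closedPolydisc d) ξ e' =
      fderivWithin ℝ (fderivWithin ℝ F (closedPolydisc d)) (closedPolydisc d) ξ e' e := by
  have h := (hF.1.fderivWithin (m := 1) uniqueDiffOn_closedPolydisc (by norm_num)).differentiableOn
    one_ne_zero ξ hξ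
  rw [fderivWithin_clm_apply (uniqueDiffOn_closedPolydisc ξ hξ) h
    (differentiableWithinAt_const _)]
  simp

theorem isSymmSndFDerivWithinAt_lift (hF : φ.IsC2BohrLift d F) {ξ : Fin d → ℂ}
    (hξ : ξ ∈ closedPolydisc d) : IsSymmSndFDerivWithinAt ℝ F (closedPolydisc d) ξ :=
  (hF.1 ξ hξ).isSymmSndFDerivWithinAt (by simp) uniqueDiffOn_closedPolydisc
    (closure_mono openPolydisc_subset_interior (closedPolydisc_subset_closure hξ)) hξ

/-- Complex linearity of the second derivative is clear in the inner direction, by differentiating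
the identity for the first derivative; symmetry transfers it to the outer direction. -/
theorem hasComplexLinearDeriv_fderivWithin_apply (hd : φ.InvolvesOnlyFirst d)
    (hF : φ.IsC2BohrLift d F) (e : Fin d → ℂ) :
    HasComplexLinearDeriv fun ξ => fderivWithin ℝ F (closedPolydisc d) ξ e := by
  refine ⟨differentiableOn_lift_fderivWithin_apply hF e, fun ξ hξ e' => ?_⟩
  have hlin := (hasComplexLinearDeriv_lift hd hF).2
  rw [fderivWithin_fderivWithin_apply hF e _ hξ, fderivWithin_fderivWithin_apply hF e _ hξ,
    isSymmSndFDerivWithinAt_lift hF hξ, isSymmSndFDerivWithinAt_lift hF hξ e' e,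
    ← fderivWithin_fderivWithin_apply hF _ _ hξ, ← fderivWithin_fderivWithin_apply hF _ _ hξ,
    fderivWithin_congr (fun ξ hξ => hlin ξ hξ e') (hlin ξ hξ e'),
    fderivWithin_const_mul (uniqueDiffOn_closedPolydisc ξ hξ)
      (differentiableOn_lift_fderivWithin_apply hF e' ξ hξ)]
  simp

theorem partialDeriv_congr {G H : (Fin d → ℂ) → ℂ} (h : Set.EqOn G H (closedPolydisc d))
    {ξ : Fin d → ℂ} (hξ : ξ ∈ closedPolydisc d) (l : Fin d) :
    partialDeriv l G ξ = partialDeriv l H ξ := by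
  rw [partialDeriv, partialDeriv, fderivWithin_congr h (h hξ)]

theorem hasComplexLinearDeriv_partialDeriv (hd : φ.InvolvesOnlyFirst d)
    (hF : φ.IsC2BohrLift d F) (l : Fin d) : HasComplexLinearDeriv (partialDeriv l F) := by
  have h := hasComplexLinearDeriv_fderivWithin_apply hd hF (Pi.single l 1)
  have heq : Set.EqOn (partialDeriv l F)
      (fun ξ => fderivWithin ℝ F (closedPolydisc d) ξ (Pi.single l 1)) (closedPolydisc d) :=
    fun ξ hξ => (hasComplexLinearDeriv_lift hd hF).partialDeriv_eq hξ l
  refine ⟨h.1.congr heq, fun ξ hξ e => ?_⟩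
  rw [fderivWithin_congr heq (heq hξ)]
  exact h.2 ξ hξ e

theorem partialDeriv_comm (hd : φ.InvolvesOnlyFirst d) (hF : φ.IsC2BohrLift d F)
    {ξ : Fin d → ℂ} (hξ : ξ ∈ closedPolydisc d) (l m : Fin d) :
    partialDeriv m (partialDeriv l F) ξ = partialDeriv l (partialDeriv m F) ξ := by
  have h : ∀ l m, partialDeriv m (partialDeriv l F) ξ =
      fderivWithin ℝ (fderivWithin ℝ F (closedPolydisc d)) (closedPolydisc d) ξ
        (Pi.single m 1) (Pi.single l 1) := by
    intro l m
    rw [partialDeriv_congr (fun ξ hξ =>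
      (hasComplexLinearDeriv_lift hd hF).partialDeriv_eq hξ l) hξ,
      (hasComplexLinearDeriv_fderivWithin_apply hd hF _).partialDeriv_eq hξ,
      fderivWithin_fderivWithin_apply hF _ _ hξ]
  rw [h, h, isSymmSndFDerivWithinAt_lift hF hξ]

end Polydisc

/-! ### Second order expansion along a tangential curve. -/

/-- Taylor's formula of order two, for a function whose derivative is differentiable at `0`. -/
theorem isLittleO_taylor_two {G G' : ℝ → ℂ} {G'' : ℂ} (h : ∀ t, HasDerivAt G (G' t) t)
    (h' : HasDerivAt G' G'' 0) :
    (fun t : ℝ => G t - G 0 - t * G' 0 - t ^ 2 * (G'' / 2)) =o[𝓝 0] fun t : ℝ => t ^ 2 := by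
  have h1 : ∀ t ∈ Set.univ, HasDerivWithinAt
      (fun t : ℝ => G t - t * G' 0 - t ^ 2 * (G'' / 2)) (G' t - G' 0 - t * G'') Set.univ t := by
    intro t _
    have e1 : HasDerivAt (fun t : ℝ => (t : ℂ)) 1 t := Complex.ofRealCLM.hasDerivAt
    have := ((h t).sub (e1.mul_const (G' 0))).sub ((e1.pow 2).mul_const (G'' / 2))
    refine (this.congr_deriv ?_).hasDerivWithinAt
    push_cast
    ring
  have h2 : (fun t : ℝ => G' t - G' 0 - t * G'') =o[𝓝[Set.univ] 0] fun t : ℝ => (t - 0) ^ 1 := by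
    have := hasDerivAt_iff_isLittleO.1 h'
    simpa [nhdsWithin_univ] using this
  have h3 := convex_univ.isLittleO_pow_succ_real (Set.mem_univ (0 : ℝ)) h1 h2
  simp only [nhdsWithin_univ, sub_zero] at h3
  refine (h3.congr_left fun t => ?_)
  push_cast
  ring

section Path

variable {d : ℕ}

/-- A curve through `z` in the closed polydisc, tangent to the polycircle. -/
def approachPath (z : Fin d → ℂ) (u : Fin d → ℝ) (t : ℝ) (l : Fin d) : ℂ :=
  z l * Complex.exp (t * (Complex.I * u l) - t ^ 2 * Real.log (primeAt l))

theorem approachPath_zero (z : Fin d → ℂ) (u : Fin d → ℝ) : approachPath z u 0 = z := by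
  funext l; simp [approachPath]

theorem approachPath_mem {z : Fin d → ℂ} (hz : z ∈ polycircle d) (u : Fin d → ℝ) (t : ℝ) :
    approachPath z u t ∈ closedPolydisc d := by
  intro l
  have hl : 0 ≤ Real.log (primeAt l) := Real.log_natCast_nonneg _
  rw [approachPath, norm_mul, hz l, one_mul, Complex.norm_exp, Real.exp_le_one_iff]
  have : (t * (Complex.I * u l) - t ^ 2 * Real.log (primeAt l) : ℂ).re =
      -(t ^ 2 * Real.log (primeAt l)) := by
    rw [← Complex.ofReal_pow, ← Complex.ofReal_mul, Complex.sub_re, Complex.ofReal_re]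
    simp
  rw [this]
  nlinarith [sq_nonneg t]

/-- The derivative of `approachPath`. -/
def approachPathDeriv (z : Fin d → ℂ) (u : Fin d → ℝ) (t : ℝ) (l : Fin d) : ℂ :=
  approachPath z u t l * (Complex.I * u l - 2 * t * Real.log (primeAt l))

theorem hasDerivAt_approachPath (z : Fin d → ℂ) (u : Fin d → ℝ) (t : ℝ) :
    HasDerivAt (approachPath z u) (approachPathDeriv z u t) t := by
  rw [hasDerivAt_pi]
  intro l
  have e1 : HasDerivAt (fun t : ℝ => (t : ℂ)) 1 t := Complex.ofRealCLM.hasDerivAt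
  have := (((e1.mul_const (Complex.I * u l)).sub
    ((e1.pow 2).mul_const (Real.log (primeAt l) : ℂ))).cexp).const_mul (z l)
  refine this.congr_deriv ?_
  simp only [approachPathDeriv, approachPath, Pi.sub_apply, Pi.pow_apply]
  push_cast
  ring

theorem hasDerivAt_approachPathDeriv (z : Fin d → ℂ) (u : Fin d → ℝ) (l : Fin d) :
    HasDerivAt (fun t => approachPathDeriv z u t l)
      (z l * ((Complex.I * u l) ^ 2 - 2 * Real.log (primeAt l))) 0 := by
  have e1 : HasDerivAt (fun t : ℝ => (t : ℂ)) 1 0 := Complex.ofRealCLM.hasDerivAt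
  have h1 := hasDerivAt_pi.1 (hasDerivAt_approachPath z u 0) l
  have h2 := ((e1.const_mul 2).mul_const (Real.log (primeAt l) : ℂ)).const_sub (Complex.I * u l)
  refine (h1.mul h2).congr_deriv ?_
  simp only [approachPathDeriv, approachPath_zero]
  push_cast
  ring

/-- The first order coefficient of `F` along `approachPath`. -/
def pathCoeffOne (F : (Fin d → ℂ) → ℂ) (z : Fin d → ℂ) (u : Fin d → ℝ) : ℂ :=
  ∑ l, z l * (Complex.I * u l) * partialDeriv l F z

/-- The second order coefficient of `F` along `approachPath`. -/
def pathCoeffTwo (F : (Fin d → ℂ) → ℂ) (z : Fin d → ℂ) (u : Fin d → ℝ) : ℂ :=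
  (∑ l, (z l * ((Complex.I * u l) ^ 2 - 2 * Real.log (primeAt l)) * partialDeriv l F z +
    z l * (Complex.I * u l) * pathCoeffOne (partialDeriv l F) z u)) / 2

/-- The derivative of `F` along the curve combines the velocity with the partial derivatives, which
again have complex linear derivatives; it is thus differentiable at 0, as `isLittleO_taylor_two`
requires. -/
theorem taylor_approachPath {φ : GordonHedenmalm} {F : (Fin d → ℂ) → ℂ}
    (hd : φ.InvolvesOnlyFirst d) (hF : φ.IsC2BohrLift d F) {z : Fin d → ℂ}
    (hz : z ∈ polycircle d) (u : Fin d → ℝ) :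
    (fun t : ℝ => F (approachPath z u t) - F z - t * pathCoeffOne F z u -
      t ^ 2 * pathCoeffTwo F z u) =o[𝓝 0] fun t : ℝ => t ^ 2 := by
  have hmem := approachPath_mem hz u
  have h1 := fun t => (hasComplexLinearDeriv_lift hd hF).hasDerivAt_comp hmem
    (hasDerivAt_approachPath z u t)
  have h2 := HasDerivAt.fun_sum (u := Finset.univ) fun l (_ : l ∈ Finset.univ) =>
    (hasDerivAt_approachPathDeriv z u l).mul
    ((hasComplexLinearDeriv_partialDeriv hd hF l).hasDerivAt_comp hmem
      (hasDerivAt_approachPath z u 0))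
  have h3 := isLittleO_taylor_two h1 h2
  refine h3.congr_left fun t => ?_
  simp only [approachPathDeriv, approachPath_zero, pathCoeffOne, pathCoeffTwo, Complex.ofReal_zero,
    mul_zero, zero_mul, sub_zero]

end Path

/-! ### Compact operators and weakly null families. -/

/-- Finitely supported vectors are dense, and against them coordinatewise convergence suffices;
boundedness controls the remainder. -/
theorem tendsto_inner_of_weakly_null {ι : Type*} {l : Filter ι} {g : ι → HardyDirichlet} {C : ℝ}
    (hg : ∀ᶠ i in l, ‖g i‖ ≤ C) (hw : ∀ n, Tendsto (fun i => g i n) l (𝓝 0))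
    (y : HardyDirichlet) : Tendsto (fun i => inner ℂ (g i) y) l (𝓝 0) := by
  rw [Metric.tendsto_nhds]
  intro δ hδ
  have hC1 : 0 < |C| + 1 := by positivity
  obtain ⟨s, hs⟩ := ((Metric.tendsto_nhds.1 (lp.hasSum_single ENNReal.ofNat_ne_top y))
    (δ / 2 / (|C| + 1)) (by positivity)).exists
  set y' : HardyDirichlet := ∑ n ∈ s, lp.single 2 n (y n) with hy'
  have h1 : Tendsto (fun i => inner ℂ (g i) y') l (𝓝 0) := by
    simp only [hy', inner_sum, lp.inner_single_right]
    rw [show (0 : ℂ) = ∑ n ∈ s, (0 : ℂ) from Finset.sum_const_zero.symm]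
    refine tendsto_finsetSum _ fun n _ => ?_
    have : Tendsto (fun i => y n * (starRingEnd ℂ) (g i n)) l (𝓝 (y n * (starRingEnd ℂ) 0)) :=
      ((Complex.continuous_conj.tendsto _).comp (hw n)).const_mul _
    simpa [mul_comm] using this
  filter_upwards [hg, (Metric.tendsto_nhds.1 h1) (δ / 2) (by positivity)] with i hi h2
  rw [dist_zero_right] at h2 ⊢
  have h3 : inner ℂ (g i) y = inner ℂ (g i) y' + inner ℂ (g i) (y - y') := by
    rw [← inner_add_right]; congr 1; abel
  have h4 : ‖inner ℂ (g i) (y - y')‖ ≤ δ / 2 := by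
    refine (norm_inner_le_norm _ _).trans ?_
    rw [dist_eq_norm, norm_sub_rev] at hs
    calc ‖g i‖ * ‖y - y'‖ ≤ (|C| + 1) * (δ / 2 / (|C| + 1)) := by
          refine mul_le_mul ?_ hs.le (norm_nonneg _) hC1.le
          linarith [le_abs_self C]
      _ = δ / 2 := by field_simp
  rw [h3]
  refine (norm_add_le _ _).trans_lt ?_
  linarith

/-- The images `T (f i)` eventually stay in a compact set, so a finite net reduces the claim to
finitely many fixed vectors. The family `f` need only be bounded. -/
theorem tendsto_inner_compact {ι : Type*} {l : Filter ι}
    {T : HardyDirichlet →L[ℂ] HardyDirichlet} (hT : IsCompactOperator T)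
    {f g : ι → HardyDirichlet} {C C' : ℝ} (hf : ∀ᶠ i in l, ‖f i‖ ≤ C)
    (hg : ∀ᶠ i in l, ‖g i‖ ≤ C') (hw : ∀ n, Tendsto (fun i => g i n) l (𝓝 0)) :
    Tendsto (fun i => inner ℂ (g i) (T (f i))) l (𝓝 0) := by
  obtain ⟨K, hK, hTK⟩ := hT.image_closedBall_subset_compact C
  rw [Metric.tendsto_nhds]
  intro δ hδ
  have hC1 : 0 < |C'| + 1 := by positivity
  obtain ⟨t, ht, hcover⟩ := Metric.totallyBounded_iff.1 hK.totallyBounded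
    (δ / 2 / (|C'| + 1)) (by positivity)
  have h1 : ∀ᶠ i in l, ∀ y ∈ t, ‖inner ℂ (g i) y‖ < δ / 2 := by
    rw [ht.eventually_all]
    intro y _
    simpa using (Metric.tendsto_nhds.1 (tendsto_inner_of_weakly_null hg hw y)) (δ / 2)
      (by positivity)
  filter_upwards [hf, hg, h1] with i hfi hgi hi
  have h2 : T (f i) ∈ K := hTK ⟨f i, by simpa using hfi, rfl⟩
  obtain ⟨y, hy, hyi⟩ := Set.mem_iUnion₂.1 (hcover h2)
  rw [Metric.mem_ball, dist_eq_norm] at hyi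
  rw [dist_zero_right]
  have h3 : inner ℂ (g i) (T (f i)) = inner ℂ (g i) y + inner ℂ (g i) (T (f i) - y) := by
    rw [← inner_add_right]; congr 1; abel
  have h4 : ‖inner ℂ (g i) (T (f i) - y)‖ ≤ δ / 2 := by
    refine (norm_inner_le_norm _ _).trans ?_
    calc ‖g i‖ * ‖T (f i) - y‖ ≤ (|C'| + 1) * (δ / 2 / (|C'| + 1)) := by
          refine mul_le_mul ?_ hyi.le (norm_nonneg _) hC1.le
          linarith [le_abs_self C']
      _ = δ / 2 := by field_simp
  rw [h3]
  refine (norm_add_le _ _).trans_lt ?_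
  linarith [hi y hy]

/-! ### Limits of the normalised factors and independence of rational functions. -/

theorem tendsto_exp_sub_one_div {ι : Type*} {l : Filter ι} {E s : ι → ℂ} {γ : ℂ}
    (hs : Tendsto s l (𝓝 0)) (hs0 : ∀ᶠ i in l, s i ≠ 0)
    (h : Tendsto (fun i => E i / s i) l (𝓝 γ)) :
    Tendsto (fun i => (Complex.exp (E i) - 1) / s i) l (𝓝 γ) := by
  have hE : Tendsto E l (𝓝 0) := by
    have := h.mul hs
    rw [mul_zero] at this
    refine this.congr' ?_
    filter_upwards [hs0] with i hi
    field_simp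
  have hd : Tendsto (dslope Complex.exp 0) (𝓝 0) (𝓝 1) := by
    have := (continuousAt_dslope_same.2 (Complex.differentiableAt_exp (x := 0))).tendsto
    rwa [dslope_same, Complex.deriv_exp, Complex.exp_zero] at this
  have h2 := (hd.comp hE).mul h
  rw [one_mul] at h2
  refine h2.congr fun i => ?_
  have := sub_smul_dslope Complex.exp 0 (E i)
  rw [sub_zero, smul_eq_mul, Complex.exp_zero] at this
  rw [← this, Function.comp]
  ring

theorem tendsto_ofReal_nhdsGT_zero : Tendsto (fun t : ℝ => (t : ℂ)) (𝓝[>] 0) (𝓝 0) := by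
  have := Complex.continuous_ofReal.tendsto 0
  rw [Complex.ofReal_zero] at this
  exact this.mono_left nhdsWithin_le_nhds

theorem eventually_ofReal_ne_zero : ∀ᶠ t : ℝ in 𝓝[>] 0, (t : ℂ) ≠ 0 := by
  filter_upwards [self_mem_nhdsWithin] with t ht
  exact_mod_cast (ne_of_gt ht)

theorem tendsto_div_sq_of_isLittleO {r : ℝ → ℂ} (hr : r =o[𝓝[>] 0] fun t : ℝ => t ^ 2) :
    Tendsto (fun t : ℝ => r t / (t : ℂ) ^ 2) (𝓝[>] 0) (𝓝 0) := by
  have : r =o[𝓝[>] 0] fun t : ℝ => (t : ℂ) ^ 2 := by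
    refine hr.trans_isBigO (Asymptotics.IsBigO.of_bound' (Eventually.of_forall fun t => ?_))
    simp
  exact this.tendsto_div_nhds_zero

/-- The behaviour of `t² / (1 - A exp (t β + t² γ + o(t²)))` as `t → 0+`. -/
theorem tendsto_sq_div_one_sub {A β γ : ℂ} {r : ℝ → ℂ} (hr : r =o[𝓝[>] 0] fun t : ℝ => t ^ 2)
    (hγ : A = 1 → β = 0 → γ ≠ 0) :
    Tendsto (fun t : ℝ => (t : ℂ) ^ 2 * (1 - A * Complex.exp (t * β + t ^ 2 * γ + r t))⁻¹)
      (𝓝[>] 0) (𝓝 (if A = 1 ∧ β = 0 then (-γ)⁻¹ else 0)) := by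
  have ht := tendsto_ofReal_nhdsGT_zero
  have ht0 := eventually_ofReal_ne_zero
  have ht2 : Tendsto (fun t : ℝ => (t : ℂ) ^ 2) (𝓝[>] 0) (𝓝 0) := by
    simpa using ht.pow 2
  have hr2 := tendsto_div_sq_of_isLittleO hr
  have hr1 : Tendsto (fun t : ℝ => (t * β + t ^ 2 * γ + r t) / (t : ℂ)) (𝓝[>] 0) (𝓝 β) := by
    have := (tendsto_const_nhds (x := β)).add ((ht.mul_const γ).add (ht.mul hr2))
    simp only [zero_mul, add_zero] at this
    refine this.congr' ?_
    filter_upwards [ht0] with t ht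
    field_simp
    ring
  split_ifs with h
  · obtain ⟨rfl, rfl⟩ := h
    have h1 : Tendsto (fun t : ℝ => (t * 0 + t ^ 2 * γ + r t) / (t : ℂ) ^ 2) (𝓝[>] 0) (𝓝 γ) := by
      have := (tendsto_const_nhds (x := γ)).add hr2
      rw [add_zero] at this
      refine this.congr' ?_
      filter_upwards [ht0] with t ht
      field_simp
      ring
    have h2 := (tendsto_exp_sub_one_div ht2 (ht0.mono fun t ht => pow_ne_zero 2 ht) h1).neg.inv₀
      (neg_ne_zero.2 (hγ rfl rfl))
    refine h2.congr fun t => ?_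
    rw [← neg_div, inv_div, div_eq_mul_inv, one_mul, neg_sub]
  · by_cases hA : A = 1
    · subst hA
      have hβ : β ≠ 0 := fun hβ => h ⟨rfl, hβ⟩
      have h2 := ht.mul ((tendsto_exp_sub_one_div ht ht0 hr1).neg.inv₀ (neg_ne_zero.2 hβ))
      rw [zero_mul] at h2
      refine h2.congr fun t => ?_
      rw [← neg_div, inv_div, div_eq_mul_inv, one_mul, neg_sub]
      ring
    · have hE : Tendsto (fun t : ℝ => t * β + t ^ 2 * γ + r t) (𝓝[>] 0) (𝓝 0) := by
        have := hr1.mul ht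
        rw [mul_zero] at this
        refine this.congr' ?_
        filter_upwards [ht0] with t ht
        field_simp
      have h1 := (((Complex.continuous_exp.tendsto 0).comp hE).const_mul A).const_sub 1
      rw [Complex.exp_zero, mul_one] at h1
      have h2 := ht2.mul (h1.inv₀ (sub_ne_zero.2 (Ne.symm hA)))
      rw [zero_mul] at h2
      exact h2

/-- Independence of the functions `x ↦ (x + X)^{-D}`. -/
theorem sum_filter_eq_zero_of_rational {ι : Type*} {K : Finset ι} {lam X : ι → ℂ} {D : ℕ}
    (hD : D ≠ 0) (hX : ∀ j ∈ K, 0 ≤ (X j).re)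
    (h : ∀ x : ℝ, 0 < x → ∑ j ∈ K, lam j * ((x + X j) ^ D)⁻¹ = 0) (y : ℂ) :
    ∑ j ∈ K with X j = y, lam j = 0 := by
  classical
  set Y := K.image X
  -- The relation with denominators cleared. The product runs over the distinct values of `X`, so
  -- each term lacks exactly its own.
  let P : Polynomial ℂ := ∑ j ∈ K, Polynomial.C (lam j) *
    ∏ y ∈ Y.erase (X j), (Polynomial.X + Polynomial.C y) ^ D
  have hev : ∀ x : ℂ, P.eval x = ∑ j ∈ K, lam j * ∏ y ∈ Y.erase (X j), (x + y) ^ D := fun x => by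
    simp [P, Polynomial.eval_finsetSum, Polynomial.eval_prod]
  have hP : P = 0 := by
    refine Polynomial.eq_zero_of_infinite_isRoot P ?_
    refine Set.Infinite.mono (s := (fun x : ℝ => (x : ℂ)) '' Set.Ioi 0) ?_
      ((Set.Ioi_infinite 0).image Complex.ofReal_injective.injOn)
    rintro _ ⟨x, hx, rfl⟩
    change P.eval (x : ℂ) = 0
    have hne : ∀ j ∈ K, ((x : ℂ) + X j) ^ D ≠ 0 := fun j hj => by
      refine pow_ne_zero _ fun h0 => ?_
      have := congrArg Complex.re h0
      simp only [Complex.add_re, Complex.ofReal_re, Complex.zero_re] at this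
      have hx' : 0 < x := hx
      linarith [hX j hj]
    rw [hev]
    calc _ = ∑ j ∈ K, (∏ y ∈ Y, ((x : ℂ) + y) ^ D) * (lam j * ((x + X j) ^ D)⁻¹) := by
          refine Finset.sum_congr rfl fun j hj => ?_
          rw [← Finset.mul_prod_erase Y _ (Finset.mem_image_of_mem X hj)]
          have := hne j hj
          field_simp
      _ = 0 := by rw [← Finset.mul_sum, h x hx, mul_zero]
  have h0 := hev (-y)
  rw [hP, Polynomial.eval_zero] at h0
  by_cases hy : y ∈ Y
  · have h1 : ∀ j ∈ K, lam j * ∏ y' ∈ Y.erase (X j), (-y + y') ^ D =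
        if X j = y then lam j * ∏ y' ∈ Y.erase y, (-y + y') ^ D else 0 := by
      intro j _
      split_ifs with hj
      · rw [hj]
      · rw [Finset.prod_eq_zero (Finset.mem_erase.2 ⟨Ne.symm hj, hy⟩) (by simp [hD]), mul_zero]
    rw [Finset.sum_congr rfl h1, ← Finset.sum_filter, ← Finset.sum_mul] at h0
    refine (mul_eq_zero.1 h0.symm).resolve_right ?_
    refine Finset.prod_ne_zero_iff.2 fun y' hy' => pow_ne_zero _ fun h => ?_
    exact (Finset.mem_erase.1 hy').1 (by linear_combination h)
  · rw [Finset.filter_false_of_mem, Finset.sum_empty]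
    exact fun j hj h => hy (h ▸ Finset.mem_image_of_mem X hj)

/-- A function with an expansion `t b + t² c + o(t²)` which is nonnegative. -/
theorem coeff_of_nonneg {f : ℝ → ℝ} {b c : ℝ}
    (h : (fun t : ℝ => f t - t * b - t ^ 2 * c) =o[𝓝 0] fun t : ℝ => t ^ 2)
    (hf : ∀ t, t ≠ 0 → 0 ≤ f t) : b = 0 ∧ 0 ≤ c := by
  have h2 : Tendsto (fun t : ℝ => (f t - t * b - t ^ 2 * c) / t ^ 2) (𝓝[≠] 0) (𝓝 0) :=
    (h.mono nhdsWithin_le_nhds).tendsto_div_nhds_zero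
  have ht : Tendsto (fun t : ℝ => t) (𝓝[≠] 0) (𝓝 0) := nhdsWithin_le_nhds
  have h1 : Tendsto (fun t : ℝ => f t / t) (𝓝[≠] 0) (𝓝 b) := by
    have := (tendsto_const_nhds (x := b)).add ((ht.mul_const c).add (ht.mul h2))
    simp only [zero_mul, add_zero] at this
    refine this.congr' ?_
    filter_upwards [self_mem_nhdsWithin] with t ht
    have ht : t ≠ 0 := ht
    field_simp
    ring
  -- Both signs of t are available: t > 0 gives b ≥ 0 and t < 0 gives b ≤ 0.
  have hb1 : 0 ≤ b := by
    refine ge_of_tendsto (h1.mono_left (nhdsWithin_mono 0 (s := Set.Ioi (0 : ℝ)) (t := {0}ᶜ)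
      fun t (ht : 0 < t) => ht.ne')) ?_
    filter_upwards [self_mem_nhdsWithin] with t ht
    exact div_nonneg (hf t (ne_of_gt ht)) (le_of_lt ht)
  have hb2 : b ≤ 0 := by
    refine le_of_tendsto (h1.mono_left (nhdsWithin_mono 0 (s := Set.Iio (0 : ℝ)) (t := {0}ᶜ)
      fun t (ht : t < 0) => ht.ne)) ?_
    filter_upwards [self_mem_nhdsWithin] with t ht
    exact div_nonpos_of_nonneg_of_nonpos (hf t (ne_of_lt ht)) (le_of_lt ht)
  have hb : b = 0 := le_antisymm hb2 hb1
  refine ⟨hb, ?_⟩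
  subst hb
  have h3 : Tendsto (fun t : ℝ => f t / t ^ 2) (𝓝[≠] 0) (𝓝 c) := by
    have := (tendsto_const_nhds (x := c)).add h2
    rw [add_zero] at this
    refine this.congr' ?_
    filter_upwards [self_mem_nhdsWithin] with t ht
    have ht : t ≠ 0 := ht
    field_simp
    ring
  refine ge_of_tendsto h3 (Eventually.of_forall fun t => ?_)
  rcases eq_or_ne t 0 with rfl | ht
  · simp
  · exact div_nonneg (hf t ht) (by positivity)

/-! ### The approach curve inside the torus picture. -/

section Path

variable {d : ℕ}

/-- The unimodular part of the approach path. -/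
def pathChar (ζ : ℕ → Circle) (u : ℕ → ℝ) (t : ℝ) (p : Nat.Primes) : Circle :=
  ζ (p : ℕ) * Circle.exp (t * u (p : ℕ))

theorem torusPoint_pathChar (ζ : ℕ → Circle) (u : ℕ → ℝ) (t : ℝ) {p : ℕ} (hp : p.Prime) :
    torusPoint (t ^ 2) (pathChar ζ u t) p =
      ζ p * Complex.exp (t * (Complex.I * u p) - t ^ 2 * Real.log p) := by
  have h1 : primeExt (pathChar ζ u t) p = ζ p * Complex.exp (t * u p * Complex.I) := by
    rw [primeExt_of_prime _ hp]
    change ((ζ p * Circle.exp (t * u p) : Circle) : ℂ) = _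
    rw [Circle.coe_mul, Circle.coe_exp]
    push_cast
    rfl
  rw [torusPoint, h1, Complex.cpow_def_of_ne_zero (by exact_mod_cast hp.ne_zero),
    Complex.natCast_log, mul_left_comm, ← Complex.exp_add]
  congr 2
  push_cast
  ring

theorem approachPath_eq_torusPoint (ζ : ℕ → Circle) (u : ℕ → ℝ) (t : ℝ) :
    approachPath (fun l : Fin d => (ζ (primeAt l) : ℂ)) (fun l => u (primeAt l)) t =
      fun l : Fin d => torusPoint (t ^ 2) (pathChar ζ u t) (primeAt l) :=
  funext fun l => (torusPoint_pathChar ζ u t (prime_primeAt l)).symm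

variable {φ : GordonHedenmalm} {F : (Fin d → ℂ) → ℂ}

theorem le_re_lift_approachPath (hd : φ.InvolvesOnlyFirst d) (hF : φ.IsC2BohrLift d F) {κ : ℝ}
    (hκ : ∀ s : ℂ, 0 < s.re → κ ≤ (φ.psi s).re) (ζ : ℕ → Circle) (u : ℕ → ℝ) {t : ℝ}
    (ht : t ≠ 0) :
    κ ≤ (F (approachPath (fun l : Fin d => (ζ (primeAt l) : ℂ)) (fun l => u (primeAt l)) t)).re := by
  rw [approachPath_eq_torusPoint]
  exact φ.le_re_lift_torusPoint hd hF (by positivity) hκ _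

theorem circle_mem_polycircle (ζ : ℕ → Circle) :
    (fun l : Fin d => (ζ (primeAt l) : ℂ)) ∈ polycircle d := fun _ => Circle.norm_coe _

/-- The real part of the lift is nonnegative along the curve and zero at its contact point, so the
curve parameter 0 is a minimum. -/
theorem pathCoeff_re (hd : φ.InvolvesOnlyFirst d) (hF : φ.IsC2BohrLift d F) (ζ : ℕ → Circle)
    (u : ℕ → ℝ) (h0 : (F fun l : Fin d => (ζ (primeAt l) : ℂ)).re = 0) :
    (pathCoeffOne F (fun l => (ζ (primeAt l) : ℂ)) fun l => u (primeAt l)).re = 0 ∧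
      0 ≤ (pathCoeffTwo F (fun l => (ζ (primeAt l) : ℂ)) fun l => u (primeAt l)).re := by
  have h := taylor_approachPath hd hF (circle_mem_polycircle ζ) fun l => u (primeAt l)
  refine coeff_of_nonneg (f := fun t => (F (approachPath (fun l : Fin d => (ζ (primeAt l) : ℂ))
    (fun l => u (primeAt l)) t)).re) ?_ fun t ht =>
      le_re_lift_approachPath hd hF (fun s hs => φ.re_psi_nonneg hs) ζ u ht
  refine Asymptotics.IsBigO.trans_isLittleO (Asymptotics.IsBigO.of_bound' (Eventually.of_forall fun t => ?_)) h
  refine le_trans (le_of_eq ?_) (Complex.abs_re_le_norm _)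
  rw [Real.norm_eq_abs]
  congr 1
  rw [← Complex.ofReal_pow]
  simp only [Complex.sub_re, Complex.re_ofReal_mul, h0, sub_zero]

end Path

theorem tendsto_sq_mul_inv_one_sub_exp {a : ℝ} (ha : 0 < a) :
    Tendsto (fun t : ℝ => t ^ 2 * (1 - Real.exp (-(t ^ 2 * a)))⁻¹) (𝓝[>] 0) (𝓝 a⁻¹) := by
  have h := tendsto_sq_div_one_sub (A := 1) (β := 0) (γ := -(a : ℂ)) (r := fun _ => 0)
    (Asymptotics.isLittleO_zero _ _) fun _ _ => neg_ne_zero.2 (by exact_mod_cast ha.ne')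
  have h2 := (Complex.continuous_re.tendsto _).comp h
  simp only [and_self, if_true, neg_neg, ← Complex.ofReal_inv, Complex.ofReal_re] at h2
  refine h2.congr fun t => ?_
  have : (t : ℂ) ^ 2 * (1 - 1 * Complex.exp (t * 0 + t ^ 2 * -(a : ℂ) + 0))⁻¹ =
      ((t ^ 2 * (1 - Real.exp (-(t ^ 2 * a)))⁻¹ : ℝ) : ℂ) := by
    push_cast
    simp
  rw [Function.comp, this, Complex.ofReal_re]

/-- Each factor of the squared norm is (1 - exp(-2t²a))⁻¹ ~ (2at²)⁻¹, and the normalisation supplies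
one t² per prime. The bound is any constant above the limit. -/
theorem exists_norm_smul_kernel_le {S : Finset ℕ} {a : ℕ → ℝ} (ha : ∀ p ∈ S, 0 < a p)
    {v : ℝ → ℕ → ℂ} (hv : ∀ t, ∀ p ∈ S, ‖v t p‖ = Real.exp (-(t ^ 2 * a p)))
    {k : ℝ → HardyDirichlet} (hk : ∀ t, 0 < t → ‖k t‖ ^ 2 = ∏ p ∈ S, (1 - ‖v t p‖ ^ 2)⁻¹) :
    ∃ C, ∀ᶠ t : ℝ in 𝓝[>] 0, ‖((t : ℂ) ^ S.card) • k t‖ ≤ C := by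
  have h1 := tendsto_finsetProd S fun p hp =>
    tendsto_sq_mul_inv_one_sub_exp (mul_pos two_pos (ha p hp))
  refine ⟨Real.sqrt (∏ p ∈ S, (2 * a p)⁻¹ + 1), ?_⟩
  filter_upwards [self_mem_nhdsWithin, h1.eventually (gt_mem_nhds (lt_add_one _))] with t ht h2
  refine Real.le_sqrt_of_sq_le (le_trans (le_of_eq ?_) h2.le)
  rw [norm_smul, mul_pow, hk t ht, norm_pow, Complex.norm_real, Real.norm_eq_abs,
    ← pow_mul, mul_comm S.card 2, pow_mul, sq_abs, ← Finset.prod_const, ← Finset.prod_mul_distrib]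
  refine Finset.prod_congr rfl fun p hp => ?_
  rw [hv t p hp, ← Real.exp_nat_mul]
  congr 4
  push_cast
  ring

/-! ### Test kernels and the limit relation forced by compactness. -/

section

variable {d : ℕ}

/-- The parameter of the test kernels. -/
def testParam (S : Finset ℕ) (ζ : ℕ → Circle) (u : ℕ → ℝ) (c : ℕ) (F₀ B : ℂ) (x t : ℝ)
    (p : ℕ) : ℂ :=
  if p ∈ S then ((ζ p : ℂ)⁻¹) ^ c * Complex.exp (Real.log p * F₀ -
    t * (Complex.I * (c * u p) - Real.log p * B) - t ^ 2 * (Real.log p * x)) else 0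

/-- As `F₀` and `B` are purely imaginary, the orders 0 and 1 are pure phases and only the term in t²
affects the modulus. -/
theorem norm_testParam {S : Finset ℕ} (ζ : ℕ → Circle) (u : ℕ → ℝ) (c : ℕ) {F₀ B : ℂ}
    (hF₀ : F₀.re = 0) (hB : B.re = 0) (x t : ℝ) {p : ℕ} (hp : p ∈ S) :
    ‖testParam S ζ u c F₀ B x t p‖ = Real.exp (-(t ^ 2 * (Real.log p * x))) := by
  rw [testParam, if_pos hp, norm_mul, norm_pow, norm_inv, Circle.norm_coe, inv_one, one_pow,
    one_mul, Complex.norm_exp]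
  congr 1
  have h1 : ((t : ℂ) ^ 2 * (Real.log p * x)).re = t ^ 2 * (Real.log p * x) := by
    rw [← Complex.ofReal_pow, ← Complex.ofReal_mul, ← Complex.ofReal_mul, Complex.ofReal_re]
  have h2 : (Complex.I * (c * u p) : ℂ).re = 0 := by
    rw [← Complex.ofReal_natCast, ← Complex.ofReal_mul]; simp
  rw [Complex.sub_re, Complex.sub_re, h1, Complex.re_ofReal_mul, Complex.re_ofReal_mul,
    Complex.sub_re, h2, Complex.re_ofReal_mul, hF₀, hB]
  ring

/-- The parameter of the kernel at the point of the approach path. -/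
def pathParam (S : Finset ℕ) (ζ : ℕ → Circle) (u : ℕ → ℝ) (t : ℝ) (p : ℕ) : ℂ :=
  if p ∈ S then (starRingEnd ℂ) (torusPoint (t ^ 2) (pathChar ζ u t) p) else 0

theorem norm_pathParam {S : Finset ℕ} (hS : ∀ p ∈ S, p.Prime) (ζ : ℕ → Circle) (u : ℕ → ℝ)
    (t : ℝ) {p : ℕ} (hp : p ∈ S) :
    ‖pathParam S ζ u t p‖ = Real.exp (-(t ^ 2 * Real.log p)) := by
  have hp0 : (0 : ℝ) < p := by exact_mod_cast (hS p hp).pos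
  rw [pathParam, if_pos hp, RCLike.norm_conj, norm_torusPoint _ _ (hS p hp),
    Real.rpow_def_of_pos hp0]
  congr 1
  ring

theorem exp_neg_lt_one {a t : ℝ} (ha : 0 < a) (ht : 0 < t) : Real.exp (-(t ^ 2 * a)) < 1 := by
  rw [Real.exp_lt_one_iff]
  have : 0 < t ^ 2 * a := by positivity
  linarith

/-- The expansion of one factor of the lifted kernel along the approach path. -/
theorem testParam_mul_eq {S : Finset ℕ} (ζ : ℕ → Circle) (u : ℕ → ℝ) (c₁ c : ℕ) (F₀ B₁ B C : ℂ)
    (F : (Fin d → ℂ) → ℂ) (x t : ℝ) {p : ℕ} (hpS : p ∈ S) (hp : p.Prime) :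
    testParam S ζ u c₁ F₀ B₁ x t p * (torusPoint (t ^ 2) (pathChar ζ u t) p ^ c *
      (p : ℂ) ^ (-F fun l : Fin d => torusPoint (t ^ 2) (pathChar ζ u t) (primeAt l))) =
    (((ζ p : ℂ)⁻¹) ^ c₁ * (ζ p : ℂ) ^ c *
      Complex.exp (Real.log p * (F₀ - F fun l : Fin d => (ζ (primeAt l) : ℂ)))) *
    Complex.exp (t * (Complex.I * ((c - c₁) * u p) - Real.log p * (B - B₁)) +
      t ^ 2 * -(Real.log p * (x + (c + C))) +
      -Real.log p * (F (approachPath (fun l : Fin d => (ζ (primeAt l) : ℂ))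
        (fun l => u (primeAt l)) t) - (F fun l : Fin d => (ζ (primeAt l) : ℂ)) - t * B -
          t ^ 2 * C)) := by
  rw [← approachPath_eq_torusPoint, torusPoint_pathChar ζ u t hp, testParam, if_pos hpS, mul_pow,
    ← Complex.exp_nat_mul, Complex.cpow_def_of_ne_zero (by exact_mod_cast hp.ne_zero),
    Complex.natCast_log]
  set G := F (approachPath (fun l : Fin d => (ζ (primeAt l) : ℂ)) (fun l => u (primeAt l)) t)
  set G₀ := F fun l : Fin d => (ζ (primeAt l) : ℂ)
  have : ∀ a b e₁ e₂ e₃ e₄ e₅ : ℂ, e₁ + (e₂ + e₃) = e₄ + e₅ →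
      a * Complex.exp e₁ * (b * Complex.exp e₂ * Complex.exp e₃) =
        a * b * Complex.exp e₄ * Complex.exp e₅ := by
    intro a b e₁ e₂ e₃ e₄ e₅ h
    calc _ = a * b * Complex.exp (e₁ + (e₂ + e₃)) := by
          rw [Complex.exp_add, Complex.exp_add]; ring
      _ = _ := by rw [h, Complex.exp_add]; ring
  refine this _ _ _ _ _ _ _ ?_
  ring

/-- The limit of a factor of the lifted kernel. -/
theorem tendsto_factor {φ : GordonHedenmalm} {F : (Fin d → ℂ) → ℂ}
    (hd : φ.InvolvesOnlyFirst d) (hF : φ.IsC2BohrLift d F) {S : Finset ℕ} (ζ : ℕ → Circle)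
    (u : ℕ → ℝ) (c₁ : ℕ) (F₀ B₁ : ℂ) (x : ℝ) {p : ℕ} (hpS : p ∈ S) (hp : p.Prime) {A β γ : ℂ}
    (hA : A = ((ζ p : ℂ)⁻¹) ^ c₁ * (ζ p : ℂ) ^ φ.char *
      Complex.exp (Real.log p * (F₀ - F fun l : Fin d => (ζ (primeAt l) : ℂ))))
    (hβ : β = Complex.I * ((φ.char - c₁) * u p) - Real.log p *
      (pathCoeffOne F (fun l => (ζ (primeAt l) : ℂ)) (fun l => u (primeAt l)) - B₁))
    (hγ : γ = -(Real.log p * (x + (φ.char +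
      pathCoeffTwo F (fun l => (ζ (primeAt l) : ℂ)) fun l => u (primeAt l)))))
    (hγ0 : A = 1 → β = 0 → γ ≠ 0) :
    Tendsto (fun t : ℝ => (t : ℂ) ^ 2 * (1 - testParam S ζ u c₁ F₀ B₁ x t p *
      (torusPoint (t ^ 2) (pathChar ζ u t) p ^ φ.char *
      (p : ℂ) ^ (-F fun l : Fin d => torusPoint (t ^ 2) (pathChar ζ u t) (primeAt l))))⁻¹)
      (𝓝[>] 0) (𝓝 (if A = 1 ∧ β = 0 then (-γ)⁻¹ else 0)) := by
  have hT := (taylor_approachPath hd hF (circle_mem_polycircle ζ) fun l => u (primeAt l)).mono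
    (nhdsWithin_le_nhds (s := Set.Ioi 0))
  refine (tendsto_sq_div_one_sub (hT.const_mul_left (-(Real.log p : ℂ))) hγ0).congr fun t => ?_
  rw [testParam_mul_eq ζ u c₁ φ.char F₀ B₁ _ _ F x t hpS hp, hA, hβ, hγ]

/-- A bound valid for every symbol, matching or not: w^c p^{-F(w)} has modulus at most 1, so the
denominator is at least 1 minus the modulus of the test parameter. -/
theorem norm_factor_le {φ : GordonHedenmalm} {F : (Fin d → ℂ) → ℂ}
    (hd : φ.InvolvesOnlyFirst d) (hF : φ.IsC2BohrLift d F) {S : Finset ℕ} (ζ : ℕ → Circle)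
    (u : ℕ → ℝ) (c₁ : ℕ) {F₀ B₁ : ℂ} (hF₀ : F₀.re = 0) (hB : B₁.re = 0) {x : ℝ} (hx : 0 < x)
    {p : ℕ} (hpS : p ∈ S) (hp : p.Prime) {t : ℝ} (ht : 0 < t) :
    ‖(t : ℂ) ^ 2 * (1 - testParam S ζ u c₁ F₀ B₁ x t p *
      (torusPoint (t ^ 2) (pathChar ζ u t) p ^ φ.char *
      (p : ℂ) ^ (-F fun l : Fin d => torusPoint (t ^ 2) (pathChar ζ u t) (primeAt l))))⁻¹‖ ≤
      t ^ 2 * (1 - Real.exp (-(t ^ 2 * (Real.log p * x))))⁻¹ := by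
  have hlog : 0 < Real.log p := Real.log_pos (by exact_mod_cast hp.one_lt)
  have h1 := exp_neg_lt_one (mul_pos hlog hx) ht
  have hy := norm_pow_mul_cpow_le_one hp
    (norm_torusPoint_lt_one (show 0 < t ^ 2 by positivity) (pathChar ζ u t) hp).le φ.char
    (φ.le_re_lift_torusPoint hd hF (show 0 < t ^ 2 by positivity) (fun s => φ.re_psi_nonneg)
      (pathChar ζ u t))
  set y := torusPoint (t ^ 2) (pathChar ζ u t) p ^ φ.char *
      (p : ℂ) ^ (-F fun l : Fin d => torusPoint (t ^ 2) (pathChar ζ u t) (primeAt l))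
  rw [norm_mul, norm_inv, norm_pow, Complex.norm_real, Real.norm_eq_abs, sq_abs]
  refine mul_le_mul_of_nonneg_left (inv_anti₀ (by linarith) ?_) (by positivity)
  calc 1 - Real.exp (-(t ^ 2 * (Real.log p * x)))
      ≤ 1 - ‖testParam S ζ u c₁ F₀ B₁ x t p * y‖ := by
        rw [norm_mul, norm_testParam ζ u c₁ hF₀ hB x t hpS]
        have := mul_le_of_le_one_right (Real.exp_pos (-(t ^ 2 * (Real.log p * x)))).le hy
        linarith
    _ ≤ ‖1 - testParam S ζ u c₁ F₀ B₁ x t p * y‖ := by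
        have := norm_sub_norm_le (1 : ℂ) (testParam S ζ u c₁ F₀ B₁ x t p * y)
        rwa [norm_one] at this

theorem mul_liftedKernel_eq (S : Finset ℕ) (v w : ℕ → ℂ) (c : ℕ) (F : (Fin d → ℂ) → ℂ) (t : ℂ) :
    (t ^ 2) ^ S.card * liftedKernel S v c F w =
      ∏ p ∈ S, t ^ 2 * (1 - v p * (w p ^ c * (p : ℂ) ^ (-F fun l => w (primeAt l))))⁻¹ := by
  rw [liftedKernel, ← Finset.prod_const, ← Finset.prod_mul_distrib]

open Classical in
/-- The asymptotic consequence of compactness along the approach path. -/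
theorem sum_rational_eq_zero {N : ℕ} {φ : Fin N → GordonHedenmalm}
    (hd : ∀ j, (φ j).InvolvesOnlyFirst d) {F : Fin N → (Fin d → ℂ) → ℂ}
    (hF : ∀ j, (φ j).IsC2BohrLift d (F j)) {lam : Fin N → ℂ}
    {T : HardyDirichlet →L[ℂ] HardyDirichlet} (hTc : IsCompactOperator T)
    (hT : ∀ f : HardyDirichlet, ∀ s ∈ halfPlane (1 / 2),
      (T f).toFun s = ∑ j, lam j * (φ j).comp f s)
    {S : Finset ℕ} (hS : ∀ p ∈ S, p.Prime) (hdS : firstPrimes d ⊆ S) (hne : S.Nonempty)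
    (ζ : ℕ → Circle) (u : ℕ → ℝ) {z : Fin d → ℂ} (hz : z = fun l : Fin d => (ζ (primeAt l) : ℂ))
    {u' : Fin d → ℝ} (hu' : u' = fun l : Fin d => u (primeAt l))
    (j₁ : Fin N) (hj₁ : (F j₁ z).re = 0) {K : Finset (Fin N)}
    (hK : ∀ j ∈ K, (φ j).char = (φ j₁).char ∧ F j z = F j₁ z ∧
      pathCoeffOne (F j) z u' = pathCoeffOne (F j₁) z u')
    (hnK : ∀ j ∉ K, ∃ p ∈ S, ((ζ p : ℂ)⁻¹) ^ (φ j₁).char * (ζ p : ℂ) ^ (φ j).char *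
        Complex.exp (Real.log p * (F j₁ z - F j z)) ≠ 1 ∨
      Complex.I * (((φ j).char - (φ j₁).char) * u p) -
        Real.log p * (pathCoeffOne (F j) z u' - pathCoeffOne (F j₁) z u') ≠ 0)
    (x : ℝ) (hx : 0 < x) :
    ∑ j ∈ K, lam j * ((x + ((φ j).char + pathCoeffTwo (F j) z u')) ^ S.card)⁻¹ = 0 := by
  have hlog : ∀ p ∈ S, 0 < Real.log p := fun p hp =>
    Real.log_pos (by exact_mod_cast (hS p hp).one_lt)
  have hB₁ : (pathCoeffOne (F j₁) z u').re = 0 := by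
    subst hz hu'; exact (pathCoeff_re (hd j₁) (hF j₁) ζ u hj₁).1
  set v : ℝ → ℕ → ℂ := testParam S ζ u (φ j₁).char (F j₁ z) (pathCoeffOne (F j₁) z u') x with hvdef
  set w : ℝ → ℕ → ℂ := fun t => torusPoint (t ^ 2) (pathChar ζ u t) with hwdef
  have hv : ∀ t, ∀ p ∈ S, ‖v t p‖ = Real.exp (-(t ^ 2 * (Real.log p * x))) := fun t p hp =>
    norm_testParam ζ u _ hj₁ hB₁ x t hp
  have hv1 : ∀ t, 0 < t → ∀ p ∈ S, ‖v t p‖ < 1 := fun t ht p hp => by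
    rw [hv t p hp]; exact exp_neg_lt_one (mul_pos (hlog p hp) hx) ht
  have hv0 : ∀ t, ∀ p ∉ S, v t p = 0 := fun t p hp => if_neg hp
  have hw1 : ∀ t, 0 < t → ∀ p ∈ S, ‖pathParam S ζ u t p‖ < 1 := fun t ht p hp => by
    rw [norm_pathParam hS ζ u t hp]; exact exp_neg_lt_one (hlog p hp) ht
  choose! f hfn hf using fun t (ht : 0 < t) => exists_kernel hS (hv1 t ht) (hv0 t)
  choose! g hgn hg using fun t (ht : 0 < t) =>
    exists_kernel hS (hw1 t ht) fun p hp => if_neg hp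
  obtain ⟨Cf, hCf⟩ := exists_norm_smul_kernel_le (fun p hp => mul_pos (hlog p hp) hx) hv hf
  obtain ⟨Cg, hCg⟩ := exists_norm_smul_kernel_le hlog
    (fun t p hp => norm_pathParam hS ζ u t hp) hg
  -- The coefficients of `g t` have modulus at most 1, so the factor t^{|S|} tends to 0
  -- coordinatewise, `S` being nonempty.
  have hwn : ∀ n : ℕ+, Tendsto (fun t : ℝ => (((t : ℂ) ^ S.card) • g t) n) (𝓝[>] 0) (𝓝 0) := by
    intro n
    have h0 : Tendsto (fun t : ℝ => ‖(t : ℂ) ^ S.card‖) (𝓝[>] 0) (𝓝 0) := by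
      have := (tendsto_ofReal_nhdsGT_zero.pow S.card).norm
      rwa [zero_pow hne.card_pos.ne', norm_zero] at this
    refine squeeze_zero_norm' ?_ h0
    filter_upwards [self_mem_nhdsWithin] with t ht
    have h1 : (((t : ℂ) ^ S.card) • g t) n = (t : ℂ) ^ S.card * g t n := rfl
    rw [h1, hgn t ht, norm_mul]
    refine mul_le_of_le_one_right (norm_nonneg _) ?_
    have : ‖cmul (pathParam S ζ u t) n‖ ≤ ‖cmul (fun _ => 1) n‖ :=
      norm_cmul_le_norm_cmul fun p _ _ => by
        by_cases hp : p ∈ S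
        · rw [norm_one]; exact (hw1 t ht p hp).le
        · rw [pathParam, if_neg hp]; simp
    rwa [cmul_const_one n.ne_zero, norm_one] at this
  have hlim := tendsto_inner_compact hTc hCf hCg hwn
  have hinner : ∀ t : ℝ, 0 < t → inner ℂ (((t : ℂ) ^ S.card) • g t) (T (((t : ℂ) ^ S.card) • f t)) =
      ∑ j, lam j * ∏ p ∈ S, (t : ℂ) ^ 2 * (1 - v t p *
        (w t p ^ (φ j).char * (p : ℂ) ^ (-F j fun l => w t (primeAt l))))⁻¹ := by
    intro t ht
    obtain ⟨hfac, hsum⟩ := tsum_apply_kernel_eq hd hF hT hS hdS (hv1 t ht) (hv0 t) (hfn t ht)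
    have h1 : inner ℂ (g t) (T (f t)) = ∑ j, lam j * liftedKernel S (v t) (φ j).char (F j) (w t) := by
      rw [← hsum (t ^ 2) (by positivity) (pathChar ζ u t), lp.inner_eq_tsum]
      refine tsum_congr fun n => ?_
      by_cases hn : T (f t) n = 0
      · rw [hn]; simp
      -- The image of `f t` is supported on integers with prime factors in `S`, so cutting the
      -- evaluation kernel down to `S` loses nothing.
      have h2 : cmul (torusPoint (t ^ 2) (pathChar ζ u t)) n = (starRingEnd ℂ) (g t n) := by
        rw [hgn t ht, ← cmul_conj]
        refine cmul_congr fun p hp hpn => ?_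
        rw [pathParam, if_pos (hfac n hn p hp hpn), Complex.conj_conj]
      rw [h2]
      rfl
    rw [map_smul, inner_smul_left, inner_smul_right, h1, ← mul_assoc, Finset.mul_sum]
    refine Finset.sum_congr rfl fun j _ => ?_
    rw [← mul_liftedKernel_eq, map_pow, Complex.conj_ofReal]
    ring
  have hfactors : ∀ j, Tendsto (fun t : ℝ => ∏ p ∈ S, (t : ℂ) ^ 2 * (1 - v t p *
        (w t p ^ (φ j).char * (p : ℂ) ^ (-F j fun l => w t (primeAt l))))⁻¹) (𝓝[>] 0)
      (𝓝 (if j ∈ K then ∏ p ∈ S, (Real.log p * (x + ((φ j).char + pathCoeffTwo (F j) z u')))⁻¹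
        else 0)) := by
    intro j
    split_ifs with hj
    · obtain ⟨hc, hFz, hBB⟩ := hK j hj
      refine tendsto_finsetProd S fun p hp => ?_
      have hA : (1 : ℂ) = ((ζ p : ℂ)⁻¹) ^ (φ j₁).char * (ζ p : ℂ) ^ (φ j).char *
          Complex.exp (Real.log p * (F j₁ z - F j z)) := by
        rw [hc, hFz, sub_self, mul_zero, Complex.exp_zero, mul_one, ← mul_pow,
          inv_mul_cancel₀ (Circle.coe_ne_zero _), one_pow]
      have hβ : (0 : ℂ) = Complex.I * (((φ j).char - (φ j₁).char) * u p) -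
          Real.log p * (pathCoeffOne (F j) z u' - pathCoeffOne (F j₁) z u') := by
        rw [hc, hBB]; ring
      have hXre : 0 ≤ (pathCoeffTwo (F j) z u').re := by
        subst hz hu'
        exact (pathCoeff_re (hd j) (hF j) ζ u (by rw [hFz]; exact hj₁)).2
      have hγ0 : -(Real.log p * (x + ((φ j).char + pathCoeffTwo (F j) z u'))) ≠ 0 := by
        refine neg_ne_zero.2 (mul_ne_zero (by exact_mod_cast (hlog p hp).ne') fun h => ?_)
        have := congrArg Complex.re h
        simp only [Complex.add_re, Complex.ofReal_re, Complex.natCast_re, Complex.zero_re] at this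
        have : (0 : ℝ) ≤ (φ j).char := Nat.cast_nonneg _
        linarith
      have h := tendsto_factor (hd j) (hF j) ζ u (φ j₁).char (F j₁ z)
        (pathCoeffOne (F j₁) z u') x hp (hS p hp) (A := 1) (β := 0)
        (by rw [hz] at hA; rwa [hz]) (by rw [hz, hu'] at hβ; rwa [hz, hu']) rfl
        (fun _ _ => by rw [hz, hu'] at hγ0; exact hγ0)
      simp only [and_self, if_true, neg_neg] at h
      rw [← hz, ← hu'] at h
      exact h
    · obtain ⟨p, hp, hpne⟩ := hnK j hj
      have h := tendsto_factor (hd j) (hF j) ζ u (φ j₁).char (F j₁ z)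
        (pathCoeffOne (F j₁) z u') x hp (hS p hp) rfl rfl rfl (by
          rw [← hz, ← hu']
          intro h1 h2
          rcases hpne with h3 | h3
          · exact absurd h1 h3
          · exact absurd h2 h3)
      rw [if_neg (by
        rw [← hz, ← hu']
        rintro ⟨h1, h2⟩
        rcases hpne with h3 | h3
        · exact absurd h1 h3
        · exact absurd h2 h3)] at h
      -- The factor at `p` tends to 0, and the others are dominated by a product with a finite
      -- limit.
      have hrest := tendsto_finsetProd (S.erase p) fun q hq =>
        tendsto_sq_mul_inv_one_sub_exp (mul_pos (hlog q (Finset.mem_of_mem_erase hq)) hx)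
      have hb := h.norm.mul hrest
      rw [norm_zero, zero_mul] at hb
      refine squeeze_zero_norm' ?_ hb
      filter_upwards [self_mem_nhdsWithin] with t ht
      rw [← Finset.mul_prod_erase S _ hp, norm_mul, norm_prod]
      refine mul_le_mul_of_nonneg_left (Finset.prod_le_prod (fun _ _ => norm_nonneg _)
        fun q hq => ?_) (norm_nonneg _)
      exact norm_factor_le (hd j) (hF j) ζ u _ hj₁ hB₁ hx (Finset.mem_of_mem_erase hq)
        (hS q (Finset.mem_of_mem_erase hq)) ht
  have hlim2 := tendsto_finsetSum (Finset.univ : Finset (Fin N)) fun j _ =>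
    (hfactors j).const_mul (lam j)
  have hlim3 := hlim2.congr' (f₂ := fun t : ℝ =>
    inner ℂ (((t : ℂ) ^ S.card) • g t) (T (((t : ℂ) ^ S.card) • f t))) (by
      filter_upwards [self_mem_nhdsWithin] with t ht
      rw [hinner t ht])
  have hzero := tendsto_nhds_unique hlim3 hlim
  simp only [mul_ite, mul_zero, Finset.sum_ite_mem, Finset.univ_inter] at hzero
  -- The factors log p are common to all j and can be cancelled.
  have hlogne : (∏ p ∈ S, (Real.log p : ℂ)⁻¹) ≠ 0 :=
    Finset.prod_ne_zero_iff.2 fun p hp => inv_ne_zero (by exact_mod_cast (hlog p hp).ne')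
  refine (mul_eq_zero.1 ?_).resolve_left hlogne
  rw [Finset.mul_sum, ← hzero]
  refine Finset.sum_congr rfl fun j _ => ?_
  simp only [mul_inv, Finset.prod_mul_distrib, Finset.prod_const, inv_pow]
  ring

end

/-! ### Generic directions and separation of boundary data. -/

/-- The product of the polynomials is nonzero, and a nonzero complex polynomial cannot vanish at all
real points. -/
theorem exists_real_eval_ne_zero {d : ℕ} {ι : Type*} [Fintype ι] (P : ι → MvPolynomial (Fin d) ℂ)
    (hP : ∀ i, P i ≠ 0) :
    ∃ u : Fin d → ℝ, ∀ i, MvPolynomial.eval (fun l => (u l : ℂ)) (P i) ≠ 0 := by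
  by_contra! h
  have hprod : ∏ i, P i ≠ 0 := Finset.prod_ne_zero_iff.2 fun i _ => hP i
  refine hprod (MvPolynomial.funext_set (fun _ => Set.range ((↑) : ℝ → ℂ))
    (fun _ => Set.infinite_range_of_injective Complex.ofReal_injective) fun x hx => ?_)
  choose u hu using fun l => hx l (Set.mem_univ l)
  obtain ⟨i, hi⟩ := h u
  have hux : (fun l => (u l : ℂ)) = x := funext hu
  rw [hux] at hi
  rw [map_prod, map_zero, Finset.prod_eq_zero (Finset.mem_univ i) hi]

/-- A nonzero `a` would be an integer multiple of both 2πi/log p and 2πi/log q, so a positive power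
of p would equal a positive power of q. -/
theorem eq_zero_of_exp_log_mul_eq_one {p q : ℕ} (hp : p.Prime) (hq : q.Prime) (hpq : p ≠ q)
    {a : ℂ} (h1 : Complex.exp (Real.log p * a) = 1) (h2 : Complex.exp (Real.log q * a) = 1) :
    a = 0 := by
  by_contra ha
  obtain ⟨n, hn⟩ := Complex.exp_eq_one_iff.1 h1
  obtain ⟨m, hm⟩ := Complex.exp_eq_one_iff.1 h2
  have hlp : 0 < Real.log p := Real.log_pos (by exact_mod_cast hp.one_lt)
  have hlq : 0 < Real.log q := Real.log_pos (by exact_mod_cast hq.one_lt)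
  have hn0 : n ≠ 0 := by
    rintro rfl
    rw [Int.cast_zero, zero_mul, mul_eq_zero] at hn
    exact hn.elim (by exact_mod_cast hlp.ne') ha
  have h3 : (m : ℝ) * Real.log p = n * Real.log q := by
    have : ((m : ℂ) * Real.log p) * a = (n * Real.log q) * a := by
      linear_combination (m : ℂ) * hn - (n : ℂ) * hm
    exact_mod_cast mul_right_cancel₀ ha this
  have hm0 : m ≠ 0 := by
    rintro rfl
    rw [Int.cast_zero, zero_mul, eq_comm, mul_eq_zero] at h3
    exact h3.elim (by exact_mod_cast hn0) hlq.ne'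
  have h4 : (m.natAbs : ℝ) * Real.log p = n.natAbs * Real.log q := by
    have := congrArg abs h3
    rw [abs_mul, abs_mul, abs_of_pos hlp, abs_of_pos hlq] at this
    rwa [Nat.cast_natAbs, Nat.cast_natAbs, Int.cast_abs, Int.cast_abs]
  rw [← Real.log_pow, ← Real.log_pow] at h4
  have h5 : (p : ℝ) ^ m.natAbs = (q : ℝ) ^ n.natAbs := Real.log_injOn_pos
    (Set.mem_Ioi.2 (pow_pos (by exact_mod_cast hp.pos) _))
    (Set.mem_Ioi.2 (pow_pos (by exact_mod_cast hq.pos) _)) h4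
  have h6 : p ^ m.natAbs = q ^ n.natAbs := by exact_mod_cast h5
  have h7 : p ∣ q ^ n.natAbs := h6 ▸ dvd_pow_self p (Int.natAbs_ne_zero.2 hm0)
  exact hpq ((Nat.prime_dvd_prime_iff_eq hp hq).1 (hp.dvd_of_dvd_pow h7))

section

variable {d : ℕ}

/-- A symmetric bilinear form vanishing on the diagonal is zero. -/
theorem eq_zero_of_forall_quadratic_eq_zero {h : Fin d → Fin d → ℂ} (hs : ∀ l m, h l m = h m l)
    (h0 : ∀ u : Fin d → ℂ, ∑ l, ∑ m, h l m * u l * u m = 0) (l m : Fin d) : h l m = 0 := by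
  have hd : ∀ l, h l l = 0 := fun l => by
    have := h0 (Pi.single l 1)
    simpa [Pi.single_apply] using this
  have h1 := h0 (Pi.single l 1 + Pi.single m 1)
  simp only [Pi.add_apply, mul_add, Finset.sum_add_distrib, Pi.single_apply, mul_ite,
    mul_one, mul_zero, Finset.sum_ite_eq', Finset.mem_univ, if_true] at h1
  simp [hd, hs m l] at h1
  exact h1

/-- The first order coefficients differ by a linear form in u, whose coefficients are the gradient
differences times i z_l. When the gradients agree, the second order coefficients differ by -1/2
times a quadratic form with coefficients z_l z_m times the Hessian differences, and symmetry
recovers these from the form. `P` is the first of the two forms that is nonzero, or 1 if there is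
none. -/
theorem exists_separating_polynomial {z : Fin d → ℂ} (hz : ∀ l, z l ≠ 0) {F G : (Fin d → ℂ) → ℂ}
    (hFs : ∀ l m, partialDeriv m (partialDeriv l F) z = partialDeriv l (partialDeriv m F) z)
    (hGs : ∀ l m, partialDeriv m (partialDeriv l G) z = partialDeriv l (partialDeriv m G) z) :
    ∃ P : MvPolynomial (Fin d) ℂ, P ≠ 0 ∧ ∀ u : Fin d → ℝ,
      MvPolynomial.eval (fun l => (u l : ℂ)) P ≠ 0 →
        (pathCoeffOne F z u = pathCoeffOne G z u →
          ∀ l, partialDeriv l F z = partialDeriv l G z) ∧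
        ((∀ l, partialDeriv l F z = partialDeriv l G z) →
          pathCoeffTwo F z u = pathCoeffTwo G z u →
          ∀ l m, partialDeriv m (partialDeriv l F) z = partialDeriv m (partialDeriv l G) z) := by
  by_cases h1 : ∀ l, partialDeriv l F z = partialDeriv l G z
  · by_cases h2 : ∀ l m, partialDeriv m (partialDeriv l F) z = partialDeriv m (partialDeriv l G) z
    · exact ⟨1, one_ne_zero, fun u _ => ⟨fun _ => h1, fun _ _ => h2⟩⟩
    · set h : Fin d → Fin d → ℂ := fun l m => z l * z m *
        (partialDeriv m (partialDeriv l F) z - partialDeriv m (partialDeriv l G) z) with hh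
      let P : MvPolynomial (Fin d) ℂ := ∑ l, ∑ m, MvPolynomial.C (h l m) * MvPolynomial.X l *
        MvPolynomial.X m
      have hev : ∀ u, MvPolynomial.eval u P = ∑ l, ∑ m, h l m * u l * u m := fun u => by
        simp [P, map_sum]
      refine ⟨P, fun hP => h2 fun l m => ?_, fun u hu => ⟨fun _ => h1, fun _ h3 => absurd ?_ hu⟩⟩
      · have := eq_zero_of_forall_quadratic_eq_zero (h := h)
          (fun l m => by simp only [hh]; rw [hFs, hGs]; ring)
          (fun u => by rw [← hev, hP, map_zero]) l m
        exact sub_eq_zero.1 ((mul_eq_zero.1 this).resolve_left (mul_ne_zero (hz l) (hz m)))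
      · rw [hev]
        simp only [pathCoeffTwo, pathCoeffOne, h1] at h3
        rw [div_left_inj' two_ne_zero, Finset.sum_add_distrib, Finset.sum_add_distrib,
          add_right_inj, ← sub_eq_zero, ← Finset.sum_sub_distrib] at h3
        rw [← neg_eq_zero, ← h3, ← Finset.sum_neg_distrib]
        refine Finset.sum_congr rfl fun l _ => ?_
        rw [← mul_sub, ← Finset.sum_sub_distrib, ← Finset.sum_neg_distrib, Finset.mul_sum]
        refine Finset.sum_congr rfl fun m _ => ?_
        simp only [hh]
        linear_combination (-(z l * z m * u l * u m * (partialDeriv m (partialDeriv l F) z -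
          partialDeriv m (partialDeriv l G) z))) * Complex.I_sq
  · push Not at h1
    obtain ⟨l₀, hl₀⟩ := h1
    let P : MvPolynomial (Fin d) ℂ := ∑ l, MvPolynomial.C (z l * Complex.I *
      (partialDeriv l F z - partialDeriv l G z)) * MvPolynomial.X l
    have hev : ∀ u, MvPolynomial.eval u P =
        ∑ l, z l * Complex.I * (partialDeriv l F z - partialDeriv l G z) * u l := fun u => by
      simp [P, map_sum]
    refine ⟨P, fun hP => ?_, fun u hu => ⟨fun h => absurd ?_ hu, fun h => absurd (h l₀) hl₀⟩⟩
    · have := hev (Pi.single l₀ 1)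
      rw [hP, map_zero] at this
      simp [Pi.single_apply, hz, sub_eq_zero, hl₀] at this
    · rw [hev, ← sub_eq_zero.2 h, pathCoeffOne, pathCoeffOne, ← Finset.sum_sub_distrib]
      exact Finset.sum_congr rfl fun l _ => by ring

/-- Among the symbols with the same boundary data, those with a given characteristic have
coefficients summing to zero. -/
theorem sum_filter_char_eq_zero {N : ℕ} {φ : Fin N → GordonHedenmalm}
    (hd : ∀ j, (φ j).InvolvesOnlyFirst d) {F : Fin N → (Fin d → ℂ) → ℂ}
    (hF : ∀ j, (φ j).IsC2BohrLift d (F j)) {lam : Fin N → ℂ}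
    (hcompact : IsCompactLinearCombination lam φ) (j₁ : Fin N) {z : Fin d → ℂ}
    (hz : z ∈ contactSet (F j₁)) {J : Finset (Fin N)}
    (hJ : ∀ j, j ∈ J ↔ SameSecondOrderBoundaryData (F j) (F j₁) z) :
    ∑ j ∈ J with (φ j).char = (φ j₁).char, lam j = 0 := by
  classical
  obtain ⟨T, hTc, hT⟩ := hcompact
  obtain ⟨hzc, hz0⟩ := hz
  have hzP : z ∈ closedPolydisc d := fun l => (hzc l).le
  have hzne : ∀ l, z l ≠ 0 := fun l h => by
    have := hzc l
    rw [h, norm_zero] at this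
    exact zero_ne_one this
  obtain ⟨ζ, hζ, -⟩ := exists_primeAt_extension (α := Circle)
    (fun l => ⟨z l, mem_sphere_zero_iff_norm.2 (hzc l)⟩) 1
  have hzζ : z = fun l : Fin d => (ζ (primeAt l) : ℂ) := funext fun l => by rw [hζ]
  choose P hP0 hP using fun j => exists_separating_polynomial hzne
    (fun l m => partialDeriv_comm (hd j) (hF j) hzP l m)
    (fun l m => partialDeriv_comm (hd j₁) (hF j₁) hzP l m)
  obtain ⟨u', hu'⟩ := exists_real_eval_ne_zero P hP0
  have hlog : ∀ l, (Real.log (primeAt l) : ℂ) ≠ 0 := fun l => by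
    exact_mod_cast (Real.log_pos (by exact_mod_cast (prime_primeAt l).one_lt)).ne'
  -- A symbol of another characteristic matches to first order at `primeAt d` for at most one value
  -- of the direction there; `y` avoids these finitely many values.
  obtain ⟨y, hy⟩ := Infinite.exists_notMem_finset (Finset.univ.image fun j : Fin N =>
    (Real.log (primeAt d) * (pathCoeffOne (F j) z u' - pathCoeffOne (F j₁) z u') /
      (Complex.I * ((φ j).char - (φ j₁).char))).re)
  obtain ⟨u, hu, huy⟩ := exists_primeAt_extension u' y
  have huu : u' = fun l : Fin d => u (primeAt l) := funext fun l => (hu l).symm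
  -- Two primes on which the lifts do not depend: the first carries the free direction `y`, and both
  -- together determine the value of a lift at z.
  set S := firstPrimes (d + 2)
  have hdS : primeAt d ∈ S := primeAt_mem_firstPrimes (by omega)
  have hdS' : primeAt (d + 1) ∈ S := primeAt_mem_firstPrimes (by omega)
  set K : Finset (Fin N) := Finset.univ.filter fun j => (φ j).char = (φ j₁).char ∧
    F j z = F j₁ z ∧ pathCoeffOne (F j) z u' = pathCoeffOne (F j₁) z u' with hKdef
  have hKmem : ∀ j, j ∈ K ↔ (φ j).char = (φ j₁).char ∧
    F j z = F j₁ z ∧ pathCoeffOne (F j) z u' = pathCoeffOne (F j₁) z u' := fun j => by simp [hKdef]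
  have hsum := sum_rational_eq_zero hd hF hTc hT (S := S) (fun _ => prime_of_mem_firstPrimes)
    (firstPrimes_mono (by omega)) ⟨_, hdS⟩ ζ u hzζ huu j₁ hz0 (K := K)
    (fun j hj => (hKmem j).1 hj) (fun j hj => by
      by_cases hc : (φ j).char = (φ j₁).char
      · have hζ1 : ∀ p, ((ζ p : ℂ)⁻¹) ^ (φ j₁).char * (ζ p : ℂ) ^ (φ j).char = 1 := fun p => by
          rw [hc, ← mul_pow, inv_mul_cancel₀ (Circle.coe_ne_zero _), one_pow]
        by_cases hFz : F j z = F j₁ z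
        · refine ⟨_, hdS, Or.inr ?_⟩
          rw [hc, sub_self, zero_mul, mul_zero, zero_sub, neg_ne_zero]
          exact mul_ne_zero (hlog d) (sub_ne_zero.2 fun h => hj ((hKmem j).2 ⟨hc, hFz, h⟩))
        · by_contra! hcon
          have h1 := (hcon _ hdS).1
          have h2 := (hcon _ hdS').1
          rw [hζ1, one_mul] at h1 h2
          refine hFz (sub_eq_zero.1 (eq_zero_of_exp_log_mul_eq_one (prime_primeAt d)
            (prime_primeAt (d + 1)) (fun h => ?_) h1 h2)).symm
          have := primeAt_injective h
          omega
      · refine ⟨_, hdS, Or.inr fun h => ?_⟩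
        rw [huy d le_rfl] at h
        refine hy (Finset.mem_image.2 ⟨j, Finset.mem_univ j, ?_⟩)
        have hne : (Complex.I * ((φ j).char - (φ j₁).char) : ℂ) ≠ 0 :=
          mul_ne_zero Complex.I_ne_zero (sub_ne_zero.2 (by exact_mod_cast hc))
        rw [← sub_eq_zero.1 h, ← mul_assoc, mul_div_cancel_left₀ _ hne, Complex.ofReal_re])
  have hX : ∀ j ∈ K, 0 ≤ ((φ j).char + pathCoeffTwo (F j) z u').re := fun j hj => by
    have h0 : (F j z).re = 0 := by rw [((hKmem j).1 hj).2.1, hz0]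
    rw [hzζ] at h0
    have := (pathCoeff_re (hd j) (hF j) ζ u h0).2
    rw [← hzζ, ← huu] at this
    rw [Complex.add_re, Complex.natCast_re]
    positivity
  have hfin := sum_filter_eq_zero_of_rational (Finset.card_ne_zero_of_mem hdS) hX hsum
    ((φ j₁).char + pathCoeffTwo (F j₁) z u')
  rw [← hfin]
  -- It remains to identify the index sets: by genericity of `u'`, equal coefficients along the
  -- curve mean equal partial derivatives.
  refine Finset.sum_congr ?_ fun _ _ => rfl
  ext j
  rw [Finset.mem_filter, Finset.mem_filter, hJ, hKmem]
  constructor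
  · rintro ⟨⟨h0, h1, h2⟩, hc⟩
    refine ⟨⟨hc, h0, ?_⟩, ?_⟩
    · simp only [pathCoeffOne, h1]
    · simp only [pathCoeffTwo, pathCoeffOne, h1, h2, hc]
  · rintro ⟨⟨hc, h0, h1⟩, h2⟩
    have h1' := (hP j u' (hu' j)).1 h1
    rw [hc, add_right_inj] at h2
    exact ⟨⟨h0, h1', (hP j u' (hu' j)).2 h1' h2⟩, hc⟩

end

end

theorem mainTheorem4 (d N : ℕ) (φ : Fin N → GordonHedenmalm)
    (hd : ∀ j, (φ j).InvolvesOnlyFirst d)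
    (F : Fin N → (Fin d → ℂ) → ℂ) (hF : ∀ j, (φ j).IsC2BohrLift d (F j))
    (lam : Fin N → ℂ) (hcompact : IsCompactLinearCombination lam φ)
    (j₁ : Fin N) (hchar : 0 < (φ j₁).char)
    (z : Fin d → ℂ) (hz : z ∈ contactSet (F j₁))
    (J : Finset (Fin N)) (hJ : ∀ j, j ∈ J ↔ SameSecondOrderBoundaryData (F j) (F j₁) z) :
    ∑ j ∈ J, lam j = 0 := by
  -- The sum vanishes separately over each value of the characteristic.
  rw [← Finset.sum_fiberwise_of_maps_to (t := J.image fun j => (φ j).char)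
    (g := fun j => (φ j).char) fun j hj => Finset.mem_image_of_mem _ hj]
  refine Finset.sum_eq_zero fun c hc => ?_
  obtain ⟨j₂, hj₂, rfl⟩ := Finset.mem_image.1 hc
  obtain ⟨h0, h1, h2⟩ := (hJ j₂).1 hj₂
  -- Any member of the class may serve as reference symbol: it has the same data, hence z is a
  -- contact point for it and `J` is also its class.
  refine sum_filter_char_eq_zero hd hF hcompact j₂ (z := z) ⟨hz.1, by rw [h0, hz.2]⟩ fun j => ?_
  rw [hJ, SameSecondOrderBoundaryData, SameSecondOrderBoundaryData, h0]
  simp only [h1, h2]
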